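/- All graphs are finite and simple. For a tree $T$ and vertices $u,v$ of $T$, let $P_T(u,v)$ be the set of vertices on the unique path from $u$ to $v$ in $T$ (so $u,v\in P_T(u,v)$). Spanning trees $T_1,\dots,T_k$ of a graph $G$ are *completely independent* if, for all $i\neq j$, $E(T_i)\cap E(T_j)=\emptyset$ and $P_{T_i}(u,v)\cap P_{T_j}(u,v)=\{u,v\}$ for all $u,v\in V(G)$. Let $\mathrm{mcist}(G)$ be the maximum integer $k$ such that $G$ has $k$ completely independent spanning trees. Let $K_m\square C_n$ be the Cartesian product of the complete graph on $m$ vertices and the cycle on $n$ vertices. **Theorem.** Let $m\ge 3$ and $n\ge 3$ be integers. The maximum defining $\mathrm{mcist}(K_m\square C_n)$ exists, and $$\mathrm{mcist}(K_m\square C_n)=\begin{cases}\lceil m/2\rceil & \text{if } m\in\{3,5\},\ \text{or } m=7 \text{ and } n\in\{3,4\},\ \text{or } m=9 \text{ and } n\in\{4,5\},\\ \lfloor m/2\rfloor & \text{otherwise.}\end{cases}$$ In particular, there are $2r$-regular, $2r$-connected graphs without $r$ completely independent spanning trees: for all integers $r\ge 4$ and $n\ge 3$, except $r=4$ with $n\in\{3,4\}$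 and $r=5$ with $n\in\{4,5\}$, the graph $K_{2r-1}\square C_n$ is $2r$-regular and $2r$-connected (it has more than $2r$ vertices and stays connected after deleting any fewer than $2r$ vertices) and does not have $r$ completely independent spanning trees. -/

import Mathlib

namespace CIST

variable {V : Type*}

/-- `T` is a spanning tree of `G` (graphs on the same vertex type, so `T` spans automatically). -/
def IsSpanningTree (G T : SimpleGraph V) : Prop :=
  T ≤ G ∧ T.IsTree

/-- The set of vertices lying on a path from `u` to `v` in `T`. When `T` is a tree this path is
unique, and this is the vertex set of that path. -/
def pathVerts (T : SimpleGraph V) (u v : V) : Set V :=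
  {w | ∃ p : T.Walk u v, p.IsPath ∧ w ∈ p.support}

/-- Two trees are internally disjoint: for all `u`, `v`, their paths between `u` and `v` share
only the end vertices. -/
def InternallyDisjoint (T T' : SimpleGraph V) : Prop :=
  ∀ u v : V, pathVerts T u v ∩ pathVerts T' u v = {u, v}

/-- `T 0, …, T (k - 1)` are completely independent spanning trees of `G`: spanning trees that are
pairwise edge-disjoint and pairwise internally disjoint. -/
structure AreCIST (G : SimpleGraph V) {k : ℕ} (T : Fin k → SimpleGraph V) : Prop where
  spanning : ∀ i, IsSpanningTree G (T i)
  edgeDisjoint : ∀ i j, i ≠ j → Disjoint (T i).edgeSet (T j).edgeSet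
  internallyDisjoint : ∀ i j, i ≠ j → InternallyDisjoint (T i) (T j)

/-- There exist `k` completely independent spanning trees in `G`. -/
def HasCIST (G : SimpleGraph V) (k : ℕ) : Prop :=
  ∃ T : Fin k → SimpleGraph V, AreCIST G T

/-- The maximum `k` such that there exist `k` completely independent spanning trees in `G`
(meaningful when such a maximum exists). -/
noncomputable def mcist (G : SimpleGraph V) : ℕ :=
  sSup {k | HasCIST G k}

/-- `G` is `k`-connected: it has more than `k` vertices, and it stays connected after the removal
of any set of fewer than `k` vertices. -/
def IsVertexConnected [Fintype V] (G : SimpleGraph V) (k : ℕ) : Prop :=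
  k < Fintype.card V ∧
    ∀ S : Finset V, S.card < k → (G.induce {v : V | v ∉ S}).Connected

/-- The Cartesian product of the complete graph on `m` vertices and the cycle on `n` vertices
(a genuine cycle for `3 ≤ n`). -/
abbrev completeBoxCycle (m n : ℕ) : SimpleGraph (Fin m × Fin n) :=
  (⊤ : SimpleGraph (Fin m)) □ SimpleGraph.cycleGraph n

end CIST

/-!
# Completely independent spanning trees in `K_m □ C_n`

Every vertex is an inner vertex of at most one of `k` completely independent spanning trees, so the
trees amount to a *partition* (`IsCISTPartition`): a colouring `c` of the vertices by `Fin k` with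
connected classes (the inner vertices of each tree), together with a pointer `p v i` from every
vertex `v` to a neighbour of each other colour `i` (the edge at the leaf `v` of the `i`-th tree),
where edge-disjointness says that no two vertices point at each other. See
`IsCISTPartition.hasCIST` and `AreCIST.exists_partition`.

**Upper bound.** The trees are edge-disjoint, so counting edges gives `2 k ≤ m + 1`. It remains to
decide, for `m = 2 k - 1`, whether `k` trees exist.

**Non-existence** (`not_hasCIST_completeBoxCycle`). Let `N = m n`. The graph is `2 k`-regular, and
counting the edges at a class of size `D` gives `N ≤ k D + 2`; since the sizes add up to `N`, some
class satisfies `k D ≤ N`, so for this class the count is almost tight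
(`IsCISTPartition.card_class_ge`). Tightness forces it to have one or two vertices in each layer
`K_m` (`IsCISTPartition.card_layerColumns_of_small`), and the number `s ≥ 1` of layers with a single
vertex satisfies `n ≤ k s ≤ n + 2`. At a layer with a single vertex, the edges towards another
colour inside the layer form a star, which has one edge too few, so each of the `k - 1` other
colours needs a vertical edge there. For `k ≥ 4` there are enough vertical edges only if one of the
two neighbouring layers is not linked to the single vertex, and then `k ≤ 5`
(`IsCISTPartition.singleton_layer`). A connected class has at most one unlinked pair of consecutive
layers (`eq_of_not_linked`), so `s ≤ 2`. The case `s = 2` is excluded by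
`IsCISTPartition.no_unlinked_singletons`; for `s = 1` there remain `k = 4` with `n ∈ {3, 4}`, and
`k = 5` with `n ∈ {3, 4, 5}`, where `n = 3` is excluded by
`IsCISTPartition.le_four_of_three_layers`.

**Existence.** A partition is described by a cyclic word of layer patterns whose conditions only
involve consecutive letters (`hasCIST_of_patterns`). The constant word with two columns per colour
gives `⌊m / 2⌋` trees. In the exceptional cases, explicit words give `⌈m / 2⌉` trees; for `m = 3`
and `m = 5` they contain a block that can be repeated (`hasCIST_of_word`), which covers all `n`.

**Connectivity.** The criterion that a vertex set with at most one unlinked pair of consecutive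
layers is connected (`connected_of_linked_of_ne`) also shows that deleting at most `m` vertices does
not disconnect the graph, so that it is `(m + 1)`-connected.

Lengths of cycles are written `n + 3` below, and layers are indexed by `Fin (n + 3)` with its cyclic
addition.
-/

open Finset

/-! ### Completely independent spanning trees and partitions -/

namespace CIST

variable {V : Type*}

/-- Breadth-first search: in a connected vertex set, every vertex other than `ρ` has a parent
of smaller height, namely a neighbour nearer to `ρ`. -/
lemma exists_parent_toward {G : SimpleGraph V} {X : Set V} (hX : (G.induce X).Connected) {ρ : V}
    (hρ : ρ ∈ X) :
    ∃ (f : V → V) (h : V → ℕ), ∀ v ∈ X, v ≠ ρ → G.Adj v (f v) ∧ f v ∈ X ∧ h (f v) < h v := by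
  classical
  have key : ∀ v : X, v.1 ≠ ρ → ∃ w : X, G.Adj v.1 w.1 ∧
      (G.induce X).dist w ⟨ρ, hρ⟩ < (G.induce X).dist v ⟨ρ, hρ⟩ := by
    intro v hv
    obtain ⟨q, hq⟩ := hX.exists_walk_length_eq_dist v ⟨ρ, hρ⟩
    cases q with
    | nil => exact absurd rfl hv
    | cons hadj q =>
      refine ⟨_, hadj, ?_⟩
      rw [← hq]
      exact lt_of_le_of_lt (SimpleGraph.dist_le q) (by simp)
  choose g hg using key
  refine ⟨fun v => if hv : v ∈ X ∧ v ≠ ρ then g ⟨v, hv.1⟩ hv.2 else v,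
    fun v => if hv : v ∈ X then (G.induce X).dist ⟨v, hv⟩ ⟨ρ, hρ⟩ else 0, fun v hv hne => ?_⟩
  have := hg ⟨v, hv⟩ hne
  simp only [hv, hne, ne_eq, not_false_eq_true, and_self, dite_true]
  simpa using this

/-- The graph joining every vertex other than `ρ` to its parent under `f`. -/
def parentGraph (ρ : V) (f : V → V) : SimpleGraph V :=
  SimpleGraph.fromRel fun u v => u ≠ ρ ∧ v = f u

lemma parentGraph_adj {ρ : V} {f : V → V} {u v : V} :
    (parentGraph ρ f).Adj u v ↔ u ≠ v ∧ ((u ≠ ρ ∧ v = f u) ∨ (v ≠ ρ ∧ u = f v)) := by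
  simp [parentGraph]

lemma parentGraph_isTree [Finite V] {ρ : V} {f : V → V} {h : V → ℕ}
    (hf : ∀ v, v ≠ ρ → h (f v) < h v) : (parentGraph ρ f).IsTree := by
  classical
  have hadj : ∀ v, v ≠ ρ → (parentGraph ρ f).Adj v (f v) := fun v hv =>
    parentGraph_adj.2 ⟨fun e => by have := hf v hv; rw [← e] at this; omega, Or.inl ⟨hv, rfl⟩⟩
  have hreach : ∀ k v, h v ≤ k → (parentGraph ρ f).Reachable v ρ := by
    intro k
    induction k with
    | zero =>
      intro v hv
      by_cases e : v = ρ
      · rw [e]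
      · have := hf v e; omega
    | succ k ih =>
      intro v hv
      by_cases e : v = ρ
      · rw [e]
      · exact (hadj v e).reachable.trans (ih _ (by have := hf v e; omega))
  have hconn : (parentGraph ρ f).Connected :=
    { preconnected := fun u v => (hreach _ u le_rfl).trans (hreach _ v le_rfl).symm
      nonempty := ⟨ρ⟩ }
  rw [SimpleGraph.isTree_iff_connected_and_card]
  refine ⟨hconn, le_antisymm ?_ hconn.card_vert_le_card_edgeSet_add_one⟩
  have hsub : (parentGraph ρ f).edgeSet ⊆ (fun v => s(v, f v)) '' {v | v ≠ ρ} := by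
    intro e
    induction e with
    | _ u v =>
      intro he
      rw [SimpleGraph.mem_edgeSet, parentGraph_adj] at he
      rcases he.2 with ⟨hu, rfl⟩ | ⟨hv, rfl⟩
      · exact ⟨u, hu, rfl⟩
      · exact ⟨v, hv, Sym2.eq_swap⟩
  have h1 : (parentGraph ρ f).edgeSet.ncard ≤ ({v | v ≠ ρ} : Set V).ncard :=
    (Set.ncard_le_ncard hsub (Set.toFinite _)).trans (Set.ncard_image_le (Set.toFinite _))
  have h2 : ({v | v ≠ ρ} : Set V).ncard + 1 = Nat.card V := by
    have := Set.ncard_add_ncard_compl ({ρ} : Set V)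
    rw [Set.ncard_singleton] at this
    have e : ({ρ} : Set V)ᶜ = {v | v ≠ ρ} := by ext; simp
    rw [e] at this
    omega
  rw [Nat.card_coe_set_eq]
  omega

lemma exists_two_adj_of_mem_path {T : SimpleGraph V} {u v w : V} {p : T.Walk u v} (hp : p.IsPath)
    (hw : w ∈ p.support) (hu : w ≠ u) (hv : w ≠ v) :
    ∃ a b, a ≠ b ∧ T.Adj w a ∧ T.Adj w b := by
  classical
  have hq := hp.takeUntil hw
  have hr := hp.dropUntil hw
  have hspec := p.take_spec hw
  set q := p.takeUntil w hw
  set r := p.dropUntil w hw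
  have hqn : ¬ q.Nil := SimpleGraph.Walk.not_nil_of_ne (Ne.symm hu)
  have hrn : ¬ r.Nil := SimpleGraph.Walk.not_nil_of_ne hv
  refine ⟨q.penultimate, r.snd, ?_, (q.adj_penultimate hqn).symm, r.adj_snd hrn⟩
  intro e
  have hnd : (q.append r).support.Nodup := by rw [hspec]; exact hp.support_nodup
  rw [SimpleGraph.Walk.support_append] at hnd
  have hdis := (List.nodup_append.1 hnd).2.2
  have h1 : q.penultimate ∈ q.support := q.getVert_mem_support _
  have h2 : r.snd ∈ r.support.tail := SimpleGraph.Walk.snd_mem_tail_support hrn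
  exact hdis _ h1 _ h2 e

/-- A colouring `c` of the vertices of `G` with a pointer `p v i` from every vertex `v` to a
neighbour of each foreign colour `i`, such that every colour class is connected and no two vertices
point at each other. The colour class of `i` plays the role of the inner vertices of the `i`-th
tree, and the pointers `p v i` are the edges joining the leaves `v` to this tree. -/
structure IsCISTPartition (G : SimpleGraph V) {k : ℕ} (c : V → Fin k) (p : V → Fin k → V) :
    Prop where
  connected : ∀ i, (G.induce {v | c v = i}).Connected
  adj : ∀ v i, i ≠ c v → G.Adj v (p v i)
  color : ∀ v i, i ≠ c v → c (p v i) = i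
  asymm : ∀ v i, i ≠ c v → p (p v i) (c v) ≠ v

/-- The `i`-th tree consists of a breadth-first tree of the class of `i` and the pointers for
`i`. -/
lemma IsCISTPartition.hasCIST [Finite V] {G : SimpleGraph V} {k : ℕ} {c : V → Fin k}
    {p : V → Fin k → V} (h : IsCISTPartition G c p) : HasCIST G k := by
  classical
  have hρ : ∀ i, ∃ v, c v = i := fun i => by
    obtain ⟨v⟩ := (h.connected i).nonempty
    exact ⟨v.1, v.2⟩
  choose ρ hρ using hρ
  have hpar := fun i => exists_parent_toward (h.connected i) (hρ i)
  choose f₀ h₀ hf₀ using hpar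
  set f : Fin k → V → V := fun i v => if c v = i then f₀ i v else p v i with hf
  have f_in : ∀ {i v}, c v = i → f i v = f₀ i v := fun e => by simp [hf, e]
  have f_out : ∀ {i v}, c v ≠ i → f i v = p v i := fun e => by simp [hf, e]
  have f_color : ∀ i v, v ≠ ρ i → c (f i v) = i := by
    intro i v hv
    by_cases e : c v = i
    · rw [f_in e]; exact (hf₀ i v e hv).2.1
    · rw [f_out e]; exact h.color v i (Ne.symm e)
  have f_adj : ∀ i v, v ≠ ρ i → G.Adj v (f i v) := by
    intro i v hv
    by_cases e : c v = i
    · rw [f_in e]; exact (hf₀ i v e hv).1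
    · rw [f_out e]; exact h.adj v i (Ne.symm e)
  have htree : ∀ i, (parentGraph (ρ i) (f i)).IsTree := by
    intro i
    refine parentGraph_isTree (h := fun v => if c v = i then h₀ i v else h₀ i (p v i) + 1) ?_
    intro v hv
    have hc := f_color i v hv
    simp only [hc, if_true]
    by_cases e : c v = i
    · rw [if_pos e, f_in e]; exact (hf₀ i v e hv).2.2
    · rw [if_neg e, f_out e]; exact Nat.lt_succ_self _
  refine ⟨fun i => parentGraph (ρ i) (f i), fun i => ⟨?_, htree i⟩, ?_, ?_⟩
  · intro u v huv
    rcases (parentGraph_adj.1 huv).2 with ⟨hu, rfl⟩ | ⟨hv, rfl⟩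
    · exact f_adj i u hu
    · exact (f_adj i v hv).symm
  · intro i j hij
    rw [Set.disjoint_left]
    intro e
    induction e with
    | _ u v =>
      intro hi hj
      rw [SimpleGraph.mem_edgeSet, parentGraph_adj] at hi hj
      -- each end that is a parent has the colour of its tree, so the ends point at each other
      have main : ∀ u v, u ≠ ρ i → v = f i u → v ≠ ρ j → u = f j v → False := by
        intro u v hu hvu hv huv
        have c1 : c v = i := hvu ▸ f_color i u hu
        have c2 : c u = j := huv ▸ f_color j v hv
        rw [f_out (by rw [c2]; exact hij.symm)] at hvu
        rw [f_out (by rw [c1]; exact hij)] at huv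
        refine h.asymm u i (by rw [c2]; exact hij) ?_
        rw [← hvu, c2, ← huv]
      have same : ∀ u, u ≠ ρ i → u ≠ ρ j → f i u = f j u → False := by
        intro u h1 h2 e
        exact hij (by rw [← f_color i u h1, e, f_color j u h2])
      rcases hi.2 with ⟨h1, h2⟩ | ⟨h1, h2⟩ <;> rcases hj.2 with ⟨h3, h4⟩ | ⟨h3, h4⟩
      · exact same u h1 h3 (h2.symm.trans h4)
      · exact main u v h1 h2 h3 h4
      · exact main v u h1 h2 h3 h4
      · exact same v h1 h3 (h2.symm.trans h4)
  · intro i j hij u v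
    have inner : ∀ i w, w ∈ pathVerts (parentGraph (ρ i) (f i)) u v → w ≠ u → w ≠ v →
        c w = i := by
      rintro i w ⟨q, hq, hw⟩ hu hv
      by_contra hc
      obtain ⟨a, b, hab, ha, hb⟩ := exists_two_adj_of_mem_path hq hw hu hv
      have only : ∀ a, (parentGraph (ρ i) (f i)).Adj w a → a = f i w := by
        intro a ha
        rcases (parentGraph_adj.1 ha).2 with ⟨_, e⟩ | ⟨h1, e⟩
        · exact e
        · exact absurd (e ▸ f_color i a h1) hc
      exact hab ((only a ha).trans (only b hb).symm)
    have ends : ∀ i, {u, v} ⊆ pathVerts (parentGraph (ρ i) (f i)) u v := by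
      intro i
      obtain ⟨q, hq⟩ := (htree i).connected.exists_isPath u v
      rintro w (rfl | rfl)
      · exact ⟨q, hq, q.start_mem_support⟩
      · exact ⟨q, hq, q.end_mem_support⟩
    refine Set.Subset.antisymm ?_ (Set.subset_inter (ends i) (ends j))
    rintro w ⟨hi, hj⟩
    by_contra hw
    simp only [Set.mem_insert_iff, Set.mem_singleton_iff, not_or] at hw
    exact hij ((inner i w hi hw.1 hw.2).symm.trans (inner j w hj hw.1 hw.2))

lemma notMem_pathVerts_trans {T : SimpleGraph V} (hT : T.IsTree) {a b d w : V}
    (h1 : w ∉ pathVerts T a b) (h2 : w ∉ pathVerts T b d) : w ∉ pathVerts T a d := by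
  classical
  rintro ⟨q, hq, hw⟩
  obtain ⟨q1, hq1⟩ := hT.connected.exists_isPath a b
  obtain ⟨q2, hq2⟩ := hT.connected.exists_isPath b d
  have e : q = (q1.append q2).bypass :=
    (hT.existsUnique_path a d).unique hq (SimpleGraph.Walk.bypass_isPath _)
  rw [e] at hw
  have := SimpleGraph.Walk.support_bypass_subset_support _ hw
  rw [SimpleGraph.Walk.mem_support_append_iff] at this
  rcases this with h | h
  · exact h1 ⟨q1, hq1, h⟩
  · exact h2 ⟨q2, hq2, h⟩

lemma pathVerts_comm (T : SimpleGraph V) (a b : V) : pathVerts T a b = pathVerts T b a := by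
  ext w
  constructor <;>
  · rintro ⟨q, hq, hw⟩
    exact ⟨q.reverse, hq.reverse, by simpa using hw⟩

lemma mem_pathVerts_of_adj {T : SimpleGraph V} {a b w : V} (hab : a ≠ b) (ha : T.Adj w a)
    (hb : T.Adj w b) : w ∈ pathVerts T a b := by
  refine ⟨.cons ha.symm (.cons hb .nil), ?_, by simp⟩
  simp [SimpleGraph.Walk.cons_isPath_iff, ha.ne', hb.ne, hab]

/-- A vertex is an inner vertex of at most one of two internally disjoint trees. -/
lemma InternallyDisjoint.not_inner_both {T T' : SimpleGraph V} (hT : T.IsTree) (hT' : T'.IsTree)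
    (h : InternallyDisjoint T T') {w a b a' b' : V} (hab : a ≠ b) (ha : T.Adj w a)
    (hb : T.Adj w b) (hab' : a' ≠ b') (ha' : T'.Adj w a') (hb' : T'.Adj w b') : False := by
  -- no pair of vertices other than `w` is separated by `w` in both trees
  have sep : ∀ x y, w ≠ x → w ≠ y → w ∈ pathVerts T x y → w ∉ pathVerts T' x y := by
    intro x y hx hy h1 h2
    have : w ∈ ({x, y} : Set V) := h x y ▸ ⟨h1, h2⟩
    rcases this with rfl | rfl
    · exact hx rfl
    · exact hy rfl
  have h0 := sep a b ha.ne hb.ne (mem_pathVerts_of_adj hab ha hb)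
  obtain ⟨x, hx, hxa⟩ : ∃ x, w ≠ x ∧ w ∈ pathVerts T' a x := by
    by_contra! hcon
    refine notMem_pathVerts_trans hT' (b := a) ?_ (hcon b' hb'.ne)
      (mem_pathVerts_of_adj hab' ha' hb')
    rw [pathVerts_comm]
    exact hcon a' ha'.ne
  have hxb : w ∈ pathVerts T' b x := by
    by_contra hcon
    exact notMem_pathVerts_trans hT' h0 hcon hxa
  have h1 : w ∉ pathVerts T a x := fun h1 => sep a x ha.ne hx h1 hxa
  have h2 : w ∉ pathVerts T b x := fun h2 => sep b x hb.ne hx h2 hxb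
  rw [pathVerts_comm] at h2
  exact notMem_pathVerts_trans hT h1 h2 (mem_pathVerts_of_adj hab ha hb)

/-- A vertex gets the colour of the tree in which it is an inner vertex, and an arbitrary colour if
it is a leaf of all trees; it points at its only neighbour in each other tree. -/
lemma AreCIST.exists_partition [Fintype V] (hV : 3 ≤ Fintype.card V) {G : SimpleGraph V} {k : ℕ}
    [NeZero k] {T : Fin k → SimpleGraph V} (h : AreCIST G T) :
    ∃ (c : V → Fin k) (p : V → Fin k → V), IsCISTPartition G c p := by
  classical
  have : Nontrivial V := Fintype.one_lt_card_iff_nontrivial.1 (by omega)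
  have htree := fun i => (h.spanning i).2
  set inner : Fin k → V → Prop := fun i v => ∃ a b, a ≠ b ∧ (T i).Adj v a ∧ (T i).Adj v b
    with hinner
  have huniq : ∀ v i j, inner i v → inner j v → i = j := by
    rintro v i j ⟨a, b, hab, ha, hb⟩ ⟨a', b', hab', ha', hb'⟩
    by_contra hij
    exact (h.internallyDisjoint i j hij).not_inner_both (htree i) (htree j) hab ha hb hab' ha' hb'
  set c : V → Fin k := fun v => if hv : ∃ i, inner i v then hv.choose else 0 with hc
  have c_inner : ∀ i v, inner i v → c v = i := by
    intro i v hv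
    have hex : ∃ i, inner i v := ⟨i, hv⟩
    simp only [hc, hex, dite_true]
    exact huniq v _ _ hex.choose_spec hv
  have hnb : ∀ v i, ∃ w, (T i).Adj v w := fun v i =>
    (htree i).connected.preconnected.exists_adj_of_nontrivial v
  choose p hp using hnb
  have p_uniq : ∀ v i w, i ≠ c v → (T i).Adj v w → w = p v i := by
    intro v i w hi hw
    by_contra hne
    exact hi (c_inner i v ⟨w, p v i, hne, hw, hp v i⟩).symm
  have p_inner : ∀ v i, i ≠ c v → inner i (p v i) := by
    intro v i hi
    by_contra hcon
    -- otherwise `v` and `p v i` form a component of the `i`-th tree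
    have honly : ∀ w, (T i).Adj (p v i) w → w = v := by
      intro w hw
      by_contra hne
      exact hcon ⟨w, v, hne, hw, (hp v i).symm⟩
    obtain ⟨x, hx⟩ : ∃ x, x ∉ ({v, p v i} : Finset V) := by
      by_contra! hcon
      have h1 : (univ : Finset V) ⊆ {v, p v i} := fun x _ => hcon x
      have h2 := card_le_card h1
      have h3 : #({v, p v i} : Finset V) ≤ 2 := card_le_two
      rw [card_univ] at h2
      omega
    obtain ⟨q⟩ := (htree i).connected.preconnected v x
    obtain ⟨d, -, hd1, hd2⟩ := q.exists_boundary_dart {v, p v i} (by simp) (by simpa using hx)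
    rcases hd1 with hd1 | hd1
    · have := d.adj
      rw [hd1] at this
      exact hd2 (Or.inr (p_uniq v i _ hi this))
    · have := d.adj
      rw [Set.mem_singleton_iff.1 hd1] at this
      exact hd2 (Or.inl (honly _ this))
  have p_color : ∀ v i, i ≠ c v → c (p v i) = i := fun v i hi => c_inner i _ (p_inner v i hi)
  refine ⟨c, p, ?_, fun v i _ => (h.spanning i).1 (hp v i), p_color, ?_⟩
  · intro i
    have hne : Nonempty {v | c v = i} := by
      obtain ⟨v⟩ := (htree i).connected.nonempty
      by_cases e : c v = i
      · exact ⟨v, e⟩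
      · exact ⟨p v i, p_color v i (Ne.symm e)⟩
    refine { preconnected := ?_, nonempty := hne }
    rintro ⟨u, hu⟩ ⟨v, hv⟩
    obtain ⟨q, hq⟩ := (htree i).connected.exists_isPath u v
    have hsup : ∀ w ∈ q.support, w ∈ {v | c v = i} := by
      intro w hw
      by_cases e1 : w = u
      · rw [e1]; exact hu
      by_cases e2 : w = v
      · rw [e2]; exact hv
      exact c_inner i w (exists_two_adj_of_mem_path hq hw e1 e2)
    have := (q.mapLe (h.spanning i).1).induce {v | c v = i} (by simpa using hsup)
    exact ⟨this⟩
  · intro v i hi e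
    have h1 : (T i).Adj v (p v i) := hp v i
    have h2 : (T (c v)).Adj v (p v i) := by
      have := hp (p v i) (c v)
      rw [e] at this
      exact this.symm
    exact Set.disjoint_left.1 (h.edgeDisjoint i (c v) hi)
      ((SimpleGraph.mem_edgeSet (T i)).2 h1) ((SimpleGraph.mem_edgeSet (T (c v))).2 h2)

lemma AreCIST.mul_card_le [Fintype V] {G : SimpleGraph V} [Fintype G.edgeSet] {k : ℕ}
    {T : Fin k → SimpleGraph V} (h : AreCIST G T) :
    k * (Fintype.card V - 1) ≤ #G.edgeFinset := by
  classical
  have h1 : #(univ.biUnion fun i => (T i).edgeFinset) = ∑ i, #(T i).edgeFinset := by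
    refine card_biUnion fun i _ j _ hij => ?_
    rw [Function.onFun, ← disjoint_coe]
    simpa using h.edgeDisjoint i j hij
  have h2 : (univ.biUnion fun i => (T i).edgeFinset) ⊆ G.edgeFinset := by
    intro e he
    simp only [mem_biUnion, mem_univ, true_and, SimpleGraph.mem_edgeFinset] at he ⊢
    obtain ⟨i, hi⟩ := he
    exact SimpleGraph.edgeSet_mono (h.spanning i).1 hi
  have h3 : ∀ i, #(T i).edgeFinset = Fintype.card V - 1 := fun i => by
    have := (h.spanning i).2.card_edgeFinset
    omega
  have h4 := card_le_card h2
  rw [h1] at h4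
  simpa [h3] using h4

end CIST

/-! ### Layers of `K_m □ C_n`, connectivity and the upper bound -/

namespace CIST

section Box

variable {m n : ℕ}

lemma completeBoxCycle_adj {u v : Fin m × Fin (n + 3)} :
    (completeBoxCycle m (n + 3)).Adj u v ↔
      (u.2 = v.2 ∧ u.1 ≠ v.1) ∨ (u.1 = v.1 ∧ (v.2 = u.2 + 1 ∨ u.2 = v.2 + 1)) := by
  rw [SimpleGraph.boxProd_adj, SimpleGraph.cycleGraph_adj, sub_eq_iff_eq_add, sub_eq_iff_eq_add,
    add_comm 1, add_comm 1, SimpleGraph.top_adj]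
  tauto

lemma layer_add_one_ne (l : Fin (n + 3)) : l + 1 ≠ l := by simp

lemma layer_add_two_ne (l : Fin (n + 3)) : l + 1 + 1 ≠ l := by
  rw [add_assoc, Ne, add_eq_left]
  intro h
  have := congrArg Fin.val h
  rw [Fin.val_add, Fin.val_one, Fin.val_zero] at this
  rw [Nat.mod_eq_of_lt (by omega)] at this
  omega

lemma layer_val_add_one (l : Fin (n + 3)) :
    (l + 1).val = if l.val = n + 2 then 0 else l.val + 1 := by
  rw [Fin.val_add_one]
  simp only [Fin.ext_iff, Fin.val_last]

lemma completeBoxCycle_degree (v : Fin m × Fin (n + 3))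
    [Fintype ((completeBoxCycle m (n + 3)).neighborSet v)] :
    (completeBoxCycle m (n + 3)).degree v = m - 1 + 2 := by
  rw [SimpleGraph.degree_boxProd, SimpleGraph.cycleGraph_degree_three_le,
    SimpleGraph.complete_graph_degree, Fintype.card_fin]

/-- `X` has two vertices in the same column in the layers `l` and `l + 1`. -/
def Linked (X : Set (Fin m × Fin (n + 3))) (l : Fin (n + 3)) : Prop :=
  ∃ a, (a, l) ∈ X ∧ (a, l + 1) ∈ X

/-- A vertex set inside an interval of layers is connected if any two consecutive layers of the
interval are linked: within a layer, all vertices are adjacent. -/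
lemma connected_of_linked_interval {X : Set (Fin m × Fin (n + 3))} (ℓ : ℕ → Fin (n + 3)) (k : ℕ)
    (hstep : ∀ t < k, ℓ (t + 1) = ℓ t + 1) (hlink : ∀ t < k, Linked X (ℓ t))
    (hX : ∀ v ∈ X, ∃ t ≤ k, v.2 = ℓ t) (hne : X.Nonempty) :
    ((completeBoxCycle m (n + 3)).induce X).Connected := by
  set H := (completeBoxCycle m (n + 3)).induce X with hH
  have same : ∀ u v : X, u.1.2 = v.1.2 → H.Reachable u v := by
    intro u v h
    by_cases e : u.1.1 = v.1.1
    · have : u = v := Subtype.ext (Prod.ext e h)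
      rw [this]
    · have : H.Adj u v := completeBoxCycle_adj.2 (Or.inl ⟨h, e⟩)
      exact this.reachable
  have key : ∀ t ≤ k, ∀ t' ≤ t, ∀ u v : X, u.1.2 = ℓ t → v.1.2 = ℓ t' → H.Reachable u v := by
    intro t
    induction t with
    | zero =>
      intro _ t' ht' u v hu hv
      obtain rfl : t' = 0 := by omega
      exact same u v (hu.trans hv.symm)
    | succ t ih =>
      intro ht t' ht' u v hu hv
      rcases Nat.lt_or_ge t t' with h | h
      · obtain rfl : t' = t + 1 := by omega
        exact same u v (hu.trans hv.symm)
      · obtain ⟨a, h1, h2⟩ := hlink t (by omega)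
        have e : H.Adj ⟨_, h2⟩ ⟨_, h1⟩ := completeBoxCycle_adj.2 (Or.inr ⟨rfl, Or.inr rfl⟩)
        refine (same u ⟨_, h2⟩ (by rw [hu, hstep t (by omega)])).trans (e.reachable.trans ?_)
        exact ih (by omega) t' h _ v rfl hv
  obtain ⟨v₀, hv₀⟩ := hne
  refine { preconnected := fun u v => ?_, nonempty := ⟨⟨v₀, hv₀⟩⟩ }
  obtain ⟨t, ht, hu⟩ := hX u.1 u.2
  obtain ⟨t', ht', hv⟩ := hX v.1 v.2
  rcases le_total t' t with h | h
  · exact key t ht t' h u v hu hv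
  · exact (key t' ht' t h v u hv hu).symm

lemma layer_ofNat_succ (s : Fin (n + 3)) (t : ℕ) :
    s + 1 + Fin.ofNat (n + 3) (t + 1) = s + 1 + Fin.ofNat (n + 3) t + 1 := by
  rw [add_assoc (s + 1)]
  congr 1
  ext
  simp [Fin.val_add]

lemma layer_eq_add_ofNat (s l : Fin (n + 3)) :
    l = s + 1 + Fin.ofNat (n + 3) (l - (s + 1)).val := by
  rw [Fin.ofNat_val_eq_self, add_sub_cancel]

lemma layer_add_ofNat_eq_iff (s : Fin (n + 3)) {t : ℕ} (ht : t < n + 3) :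
    s + 1 + Fin.ofNat (n + 3) t = s ↔ t = n + 2 := by
  rw [add_assoc, add_eq_left, Fin.ext_iff, add_comm (1 : Fin (n + 3)), layer_val_add_one]
  have : (Fin.ofNat (n + 3) t).val = t := Nat.mod_eq_of_lt ht
  rw [this, Fin.val_zero]
  split_ifs with h <;> simp [h]

lemma connected_of_linked_of_ne {X : Set (Fin m × Fin (n + 3))} (g : Fin (n + 3))
    (hlink : ∀ l, l ≠ g → Linked X l) :
    ((completeBoxCycle m (n + 3)).induce X).Connected := by
  refine connected_of_linked_interval (fun t => g + 1 + Fin.ofNat (n + 3) t) (n + 2)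
    (fun t _ => layer_ofNat_succ g t) (fun t ht => hlink _ ?_) (fun v _ => ?_) ?_
  · rw [Ne, layer_add_ofNat_eq_iff g (by omega)]
    omega
  · exact ⟨(v.2 - (g + 1)).val, by omega, layer_eq_add_ofNat g v.2⟩
  · obtain ⟨a, h, -⟩ := hlink (g + 1) (layer_add_one_ne g)
    exact ⟨_, h⟩

/-- In a connected vertex set that meets every layer, at most one pair of consecutive layers is not
linked: two such pairs would cut the cycle of layers into two arcs. -/
lemma eq_of_not_linked {X : Set (Fin m × Fin (n + 3))}
    (hX : ((completeBoxCycle m (n + 3)).induce X).Connected) (hlayer : ∀ l, ∃ a, (a, l) ∈ X)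
    {g₁ g₂ : Fin (n + 3)} (h₁ : ¬ Linked X g₁) (h₂ : ¬ Linked X g₂) : g₁ = g₂ := by
  by_contra hne
  obtain ⟨a, ha⟩ := hlayer (g₁ + 1)
  obtain ⟨b, hb⟩ := hlayer g₁
  have hlast : ∀ l : Fin (n + 3), (l - (g₁ + 1)).val = n + 2 ↔ l = g₁ := by
    intro l
    rw [← layer_add_ofNat_eq_iff g₁ (t := (l - (g₁ + 1)).val) (by omega), ← layer_eq_add_ofNat]
  set A : Set X := {v | (v.1.2 - (g₁ + 1)).val ≤ (g₂ - (g₁ + 1)).val} with hA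
  obtain ⟨q⟩ := hX.preconnected ⟨_, ha⟩ ⟨_, hb⟩
  have hg₂ : (g₂ - (g₁ + 1)).val ≠ n + 2 := fun h => hne ((hlast g₂).1 h).symm
  have hval : ∀ l : Fin (n + 3), (l + 1 - (g₁ + 1)).val =
      if (l - (g₁ + 1)).val = n + 2 then 0 else (l - (g₁ + 1)).val + 1 := by
    intro l
    rw [← layer_val_add_one, sub_add_eq_add_sub]
  obtain ⟨d, -, hd1, hd2⟩ := q.exists_boundary_dart A (by simp [hA]) (by
    simp only [hA, Set.mem_ofPred_eq, not_le]
    rw [(hlast g₁).2 rfl]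
    omega)
  have hadj : (completeBoxCycle m (n + 3)).Adj d.fst.1 d.snd.1 := d.adj
  rcases completeBoxCycle_adj.1 hadj with ⟨h, -⟩ | ⟨hcol, h | h⟩
  · exact hd2 (by rw [hA, Set.mem_ofPred_eq, ← h]; exact hd1)
  · simp only [hA, Set.mem_ofPred_eq, not_le] at hd1 hd2
    have hl : d.fst.1.2 = g₂ := by
      rw [← sub_left_inj (a := g₁ + 1), Fin.ext_iff]
      rw [h, hval] at hd2
      split_ifs at hd2 <;> omega
    refine h₂ ⟨d.fst.1.1, ?_, ?_⟩
    · rw [← hl]; exact d.fst.2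
    · rw [← hl, ← h, hcol]; exact d.snd.2
  · simp only [hA, Set.mem_ofPred_eq, not_le] at hd1 hd2
    have hl : d.snd.1.2 = g₁ := by
      rw [← hlast]
      rw [h, hval] at hd1
      split_ifs at hd1 <;> omega
    refine h₁ ⟨d.snd.1.1, ?_, ?_⟩
    · rw [← hl]; exact d.snd.2
    · rw [← hl, ← h, ← hcol]; exact d.fst.2

/-- If at most `m` vertices are deleted and the rest has no link between the layers `l` and `l + 1`,
then all deleted vertices lie in these two layers: every column must lose a vertex there. -/
lemma layer_of_not_linked_compl {S : Finset (Fin m × Fin (n + 3))} (hS : #S ≤ m)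
    {l : Fin (n + 3)} (hl : ¬ Linked {v | v ∉ S} l) {v : Fin m × Fin (n + 3)} (hv : v ∈ S) :
    v.2 = l ∨ v.2 = l + 1 := by
  classical
  have h : ∀ a, ∃ l', (l' = l ∨ l' = l + 1) ∧ (a, l') ∈ S := by
    intro a
    by_contra! hcon
    exact hl ⟨a, hcon l (Or.inl rfl), hcon (l + 1) (Or.inr rfl)⟩
  choose f hf1 hf2 using h
  have himg : univ.image (fun a => (a, f a)) = S := by
    refine eq_of_subset_of_card_le ?_ ?_
    · intro w hw
      obtain ⟨a, -, rfl⟩ := mem_image.1 hw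
      exact hf2 a
    · rw [card_image_of_injective _ fun a b hab => (Prod.ext_iff.1 hab).1, card_univ,
        Fintype.card_fin]
      exact hS
  rw [← himg] at hv
  obtain ⟨a, -, rfl⟩ := mem_image.1 hv
  exact hf1 a

/-- Deleting a whole layer leaves a path of linked layers; otherwise the remaining vertices meet
every layer, and two unlinked pairs of layers would put all deleted vertices into one common layer. -/
lemma completeBoxCycle_isVertexConnected (hm : 1 ≤ m) :
    IsVertexConnected (completeBoxCycle m (n + 3)) (m + 1) := by
  classical
  refine ⟨?_, fun S hS => ?_⟩
  · rw [Fintype.card_prod, Fintype.card_fin, Fintype.card_fin]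
    nlinarith
  by_cases hfull : ∃ l₀, ∀ a, (a, l₀) ∈ S
  · obtain ⟨l₀, hl₀⟩ := hfull
    have himg : univ.image (fun a : Fin m => (a, l₀)) = S := by
      refine eq_of_subset_of_card_le ?_ ?_
      · intro w hw
        obtain ⟨a, -, rfl⟩ := mem_image.1 hw
        exact hl₀ a
      · rw [card_image_of_injective _ fun a b hab => (Prod.ext_iff.1 hab).1, card_univ,
          Fintype.card_fin]
        omega
    have hmem : ∀ v, v ∉ S ↔ v.2 ≠ l₀ := by
      intro v
      rw [← himg]
      simp only [mem_image, mem_univ, true_and, not_exists]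
      constructor
      · intro h e
        exact h v.1 (by rw [← e])
      · rintro h a rfl
        exact h rfl
    have hval : ∀ l, l ≠ l₀ → (l - (l₀ + 1)).val ≤ n + 1 := by
      intro l hl
      have h1 := layer_add_ofNat_eq_iff l₀ (t := (l - (l₀ + 1)).val) (by omega)
      rw [← layer_eq_add_ofNat] at h1
      have := mt h1.2 hl
      omega
    refine connected_of_linked_interval (fun t => l₀ + 1 + Fin.ofNat (n + 3) t) (n + 1)
      (fun t _ => layer_ofNat_succ l₀ t) (fun t ht => ⟨⟨0, hm⟩, ?_, ?_⟩) (fun v hv => ?_)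
      ⟨(⟨0, hm⟩, l₀ + 1), ?_⟩
    · rw [Set.mem_ofPred_eq, hmem, Ne, layer_add_ofNat_eq_iff l₀ (by omega)]
      omega
    · rw [Set.mem_ofPred_eq, hmem, Ne, ← layer_ofNat_succ, layer_add_ofNat_eq_iff l₀ (by omega)]
      omega
    · exact ⟨(v.2 - (l₀ + 1)).val, hval _ ((hmem v).1 hv), layer_eq_add_ofNat l₀ v.2⟩
    · rw [Set.mem_ofPred_eq, hmem]
      exact layer_add_one_ne l₀
  · push Not at hfull
    by_cases hg : ∃ g, ¬ Linked {v | v ∉ S} g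
    · obtain ⟨g, hg⟩ := hg
      refine connected_of_linked_of_ne g fun l hl => ?_
      by_contra hcon
      -- the deleted vertices lie in the only layer common to both unlinked pairs
      have hcommon : ∃ l₀, ∀ v ∈ S, v.2 = l₀ := by
        by_cases e : l = g + 1
        · refine ⟨g + 1, fun v hv => ?_⟩
          rcases layer_of_not_linked_compl (by omega) hg hv with h | h
          · rcases layer_of_not_linked_compl (by omega) hcon hv with h' | h'
            · rw [h', e]
            · exact absurd (by rw [← e, ← h', h]) (layer_add_two_ne g)
          · exact h
        · refine ⟨g, fun v hv => ?_⟩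
          rcases layer_of_not_linked_compl (by omega) hg hv with h | h
          · exact h
          · rcases layer_of_not_linked_compl (by omega) hcon hv with h' | h'
            · exact absurd (h'.symm.trans h) e
            · exact absurd (add_right_cancel (h'.symm.trans h)) hl
      obtain ⟨l₀, hl₀⟩ := hcommon
      obtain ⟨a, ha⟩ := hfull l₀
      have h : ∃ l', (a, l') ∈ S := by
        by_contra! h
        exact hg ⟨a, h _, h _⟩
      obtain ⟨l', hl'⟩ := h
      have : l' = l₀ := hl₀ _ hl'
      exact ha (this ▸ hl')
    · push Not at hg
      exact connected_of_linked_of_ne 0 fun l _ => hg l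

/-- Edge-disjointness alone gives the upper bound `⌈m / 2⌉` on the number of trees. -/
lemma HasCIST.le_of_completeBoxCycle (hm : 3 ≤ m) {k : ℕ}
    (h : HasCIST (completeBoxCycle m (n + 3)) k) : 2 * k ≤ m + 1 := by
  classical
  obtain ⟨T, hT⟩ := h
  have h1 := hT.mul_card_le
  have h2 := (completeBoxCycle m (n + 3)).sum_degrees_eq_twice_card_edges
  simp only [completeBoxCycle_degree, sum_const, card_univ, Fintype.card_prod, Fintype.card_fin,
    smul_eq_mul] at h1 h2
  by_contra! hk
  obtain ⟨N, hN⟩ : ∃ N, m * (n + 3) = N + 1 := ⟨m * (n + 3) - 1, by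
    have : 0 < m * (n + 3) := by positivity
    omega⟩
  have h3 : m * 3 ≤ m * (n + 3) := Nat.mul_le_mul_left _ (by omega)
  rw [hN] at h1 h2
  have h4 : (m + 2) * N ≤ 2 * k * N := Nat.mul_le_mul_right _ (by omega)
  have h5 : m - 1 + 2 = m + 1 := by omega
  rw [h5] at h2
  simp only [Nat.add_sub_cancel] at h1
  nlinarith

end Box

end CIST

/-! ### Partitions from words of layer patterns -/

namespace CIST

/-- A colouring of one layer `Fin m` with `k` colours together with its pointers: a vertex in column
`a` points, for the colour `i`, at the column `target a i` of its own layer if `target a i < m`,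
one layer up if `target a i = m`, and one layer down otherwise. -/
structure LayerPattern (m k : ℕ) where
  color : Fin m → Fin k
  target : Fin m → Fin k → ℕ

namespace LayerPattern

variable {m k : ℕ}

/-- The pointers inside the layer hit their colours and are not mutual. -/
def IsValid (σ : LayerPattern m k) : Prop :=
  ∀ a i, i ≠ σ.color a → ∀ h : σ.target a i < m,
    σ.color ⟨_, h⟩ = i ∧ σ.target ⟨_, h⟩ (σ.color a) ≠ a

/-- The pointers between the layer `σ` and the layer `τ` above it hit their colours and are not
mutual. -/
def IsCompatible (σ τ : LayerPattern m k) : Prop :=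
  (∀ a i, i ≠ σ.color a → σ.target a i = m →
    τ.color a = i ∧ τ.target a (σ.color a) ≤ m) ∧
  (∀ a i, i ≠ τ.color a → m < τ.target a i →
    σ.color a = i ∧ σ.target a (τ.color a) ≠ m)

/-- Some column has colour `i` in both layers. -/
def IsLinked (σ τ : LayerPattern m k) (i : Fin k) : Prop :=
  ∃ a, σ.color a = i ∧ τ.color a = i

instance (σ : LayerPattern m k) : Decidable σ.IsValid := by
  unfold IsValid; infer_instance

instance (σ τ : LayerPattern m k) : Decidable (σ.IsCompatible τ) := by
  unfold IsCompatible; infer_instance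

instance (σ τ : LayerPattern m k) (i : Fin k) : Decidable (σ.IsLinked τ i) := by
  unfold IsLinked; infer_instance

end LayerPattern

section Patterns

variable {m n k : ℕ}

/-- A cyclic sequence of compatible layer patterns in which every colour has at most one unlinked
pair of consecutive layers yields completely independent spanning trees. -/
lemma hasCIST_of_patterns (w : Fin (n + 3) → LayerPattern m k) (γ : Fin k → Fin (n + 3))
    (hv : ∀ l, (w l).IsValid) (hc : ∀ l, (w l).IsCompatible (w (l + 1)))
    (hl : ∀ i l, l ≠ γ i → (w l).IsLinked (w (l + 1)) i) :
    HasCIST (completeBoxCycle m (n + 3)) k := by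
  set c : Fin m × Fin (n + 3) → Fin k := fun v => (w v.2).color v.1 with hcdef
  set p : Fin m × Fin (n + 3) → Fin k → Fin m × Fin (n + 3) := fun v i =>
    if h : (w v.2).target v.1 i < m then (⟨_, h⟩, v.2)
    else if (w v.2).target v.1 i = m then (v.1, v.2 + 1) else (v.1, v.2 - 1) with hp
  have main : ∀ v i, i ≠ c v → (completeBoxCycle m (n + 3)).Adj v (p v i) ∧ c (p v i) = i ∧
      p (p v i) (c v) ≠ v := by
    rintro ⟨a, l⟩ i hi
    by_cases h1 : (w l).target a i < m
    · have e : p (a, l) i = (⟨_, h1⟩, l) := by simp [hp, h1]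
      obtain ⟨h2, h3⟩ := hv l a i hi h1
      rw [e]
      refine ⟨completeBoxCycle_adj.2 (Or.inl ⟨rfl, ?_⟩), h2, ?_⟩
      · intro e'
        have e' : a = ⟨_, h1⟩ := e'
        rw [← e'] at h2
        exact hi h2.symm
      · intro e'
        by_cases h4 : (w l).target ⟨_, h1⟩ ((w l).color a) < m
        · have : p (⟨_, h1⟩, l) (c (a, l)) = (⟨_, h4⟩, l) := by simp [hp, hcdef, h4]
          rw [this] at e'
          exact h3 (congrArg Fin.val (Prod.ext_iff.1 e').1)
        · by_cases h5 : (w l).target ⟨_, h1⟩ ((w l).color a) = m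
          · have : p (⟨_, h1⟩, l) (c (a, l)) = (⟨_, h1⟩, l + 1) := by simp [hp, hcdef, h5]
            rw [this] at e'
            exact layer_add_one_ne l (Prod.ext_iff.1 e').2
          · have : p (⟨_, h1⟩, l) (c (a, l)) = (⟨_, h1⟩, l - 1) := by simp [hp, hcdef, h4, h5]
            rw [this] at e'
            have e2 : l - 1 = l := (Prod.ext_iff.1 e').2
            exact layer_add_one_ne (l - 1) (by rw [sub_add_cancel]; exact e2.symm)
    · by_cases h2 : (w l).target a i = m
      · have e : p (a, l) i = (a, l + 1) := by simp [hp, h2]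
        obtain ⟨h3, h4⟩ := (hc l).1 a i hi h2
        rw [e]
        refine ⟨completeBoxCycle_adj.2 (Or.inr ⟨rfl, Or.inl rfl⟩), h3, ?_⟩
        intro e'
        by_cases h5 : (w (l + 1)).target a ((w l).color a) < m
        · have : p (a, l + 1) (c (a, l)) = (⟨_, h5⟩, l + 1) := by simp [hp, hcdef, h5]
          rw [this] at e'
          exact layer_add_one_ne l (Prod.ext_iff.1 e').2
        · have h6 : (w (l + 1)).target a ((w l).color a) = m := by omega
          have : p (a, l + 1) (c (a, l)) = (a, l + 1 + 1) := by simp [hp, hcdef, h6]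
          rw [this] at e'
          exact layer_add_two_ne l (Prod.ext_iff.1 e').2
      · have e : p (a, l) i = (a, l - 1) := by simp [hp, h1, h2]
        have hc' := hc (l - 1)
        rw [sub_add_cancel] at hc'
        obtain ⟨h3, h4⟩ := hc'.2 a i hi (by omega)
        rw [e]
        refine ⟨completeBoxCycle_adj.2 (Or.inr ⟨rfl, Or.inr (sub_add_cancel l 1).symm⟩), h3, ?_⟩
        intro e'
        by_cases h5 : (w (l - 1)).target a ((w l).color a) < m
        · have : p (a, l - 1) (c (a, l)) = (⟨_, h5⟩, l - 1) := by simp [hp, hcdef, h5]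
          rw [this] at e'
          have e2 : l - 1 = l := (Prod.ext_iff.1 e').2
          exact layer_add_one_ne (l - 1) (by rw [sub_add_cancel]; exact e2.symm)
        · have : p (a, l - 1) (c (a, l)) = (a, l - 1 - 1) := by simp [hp, hcdef, h4, h5]
          rw [this] at e'
          have e2 : l - 1 - 1 = l := (Prod.ext_iff.1 e').2
          exact layer_add_two_ne (l - 1 - 1) (by rw [sub_add_cancel, sub_add_cancel]; exact e2.symm)
  have hpart : IsCISTPartition (completeBoxCycle m (n + 3)) c p :=
    { connected := fun i => connected_of_linked_of_ne (γ i) fun l hli => hl i l hli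
      adj := fun v i hi => (main v i hi).1
      color := fun v i hi => (main v i hi).2.1
      asymm := fun v i hi => (main v i hi).2.2 }
  exact hpart.hasCIST

/-- The index `t` can follow the index `s` in the cyclic words made of the letters `0, …, b - 1`
and then any number of copies of the block `b, …, b + d - 1`. -/
def IsSuccessor (b d s t : ℕ) : Prop :=
  t = s + 1 ∨ (s + 1 = b + d ∧ (t = b ∨ t = 0)) ∨ (s + 1 = b ∧ t = 0)

instance (b d s t : ℕ) : Decidable (IsSuccessor b d s t) := by
  unfold IsSuccessor; infer_instance

/-- Layer patterns `D` in which every possible succession in a word of `b` letters and `q` copies of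
a block of `d` letters is compatible yield completely independent spanning trees on all cycles of
length `b + d q`. The only unlinked pair of the colour `i` starts at the letter `γ i`. -/
lemma hasCIST_of_word (b d q : ℕ) (hb : b + d * q = n + 3) (D : Fin (b + d) → LayerPattern m k)
    (γ : Fin k → Fin (b + d)) (hγ : ∀ i, (γ i).val < b)
    (hv : ∀ s, (D s).IsValid)
    (hc : ∀ s t : Fin (b + d), IsSuccessor b d s t → (D s).IsCompatible (D t))
    (hl : ∀ i (s t : Fin (b + d)), IsSuccessor b d s t → s ≠ γ i → (D s).IsLinked (D t) i) :
    HasCIST (completeBoxCycle m (n + 3)) k := by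
  have hd : ∀ l : Fin (n + 3), ¬ l.val < b → 0 < d := by
    intro l h
    by_contra h0
    obtain rfl : d = 0 := by omega
    omega
  set ι : Fin (n + 3) → Fin (b + d) := fun l =>
    if h : l.val < b then ⟨l.val, by omega⟩
    else ⟨b + (l.val - b) % d, by have := Nat.mod_lt (l.val - b) (hd l h); omega⟩ with hι
  have ι_lt : ∀ l : Fin (n + 3), l.val < b → (ι l).val = l.val := fun l h => by simp [hι, h]
  have ι_ge : ∀ l : Fin (n + 3), ¬ l.val < b → (ι l).val = b + (l.val - b) % d :=
    fun l h => by simp [hι, h]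
  have hsucc : ∀ l, IsSuccessor b d (ι l) (ι (l + 1)) := by
    intro l
    have hval := layer_val_add_one l
    by_cases hlast : l.val = n + 2
    · rw [if_pos hlast] at hval
      by_cases hb0 : b = 0
      · subst hb0
        rw [ι_ge l (by omega), ι_ge (l + 1) (by omega), hval, hlast]
        obtain ⟨q, rfl⟩ : ∃ q', q = q' + 1 := ⟨q - 1, by
          rcases q with _ | q
          · simp at hb
          · rfl⟩
        have hdpos := hd l (by omega)
        have : n + 2 - 0 = (d - 1) + d * q := by
          have : d * (q + 1) = d * q + d := by ring
          omega
        rw [this, Nat.add_mul_mod_self_left, Nat.mod_eq_of_lt (by omega)]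
        right; left
        exact ⟨by omega, Or.inr (by simp)⟩
      · rw [ι_lt (l + 1) (by omega), hval]
        by_cases h : l.val < b
        · rw [ι_lt l h]
          have h0 : d * q = 0 := by omega
          right; right
          exact ⟨by omega, rfl⟩
        · rw [ι_ge l h]
          obtain ⟨q, rfl⟩ : ∃ q', q = q' + 1 := ⟨q - 1, by
            rcases q with _ | q
            · simp at hb; omega
            · rfl⟩
          have hdpos := hd l h
          have : l.val - b = (d - 1) + d * q := by
            have : d * (q + 1) = d * q + d := by ring
            omega
          rw [this, Nat.add_mul_mod_self_left, Nat.mod_eq_of_lt (by omega)]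
          right; left
          exact ⟨by omega, Or.inr rfl⟩
    · rw [if_neg hlast] at hval
      by_cases h : l.val + 1 < b
      · rw [ι_lt l (by omega), ι_lt (l + 1) (by omega), hval]
        exact Or.inl rfl
      · rw [ι_ge (l + 1) (by omega), hval]
        by_cases h' : l.val < b
        · rw [ι_lt l h']
          have : l.val + 1 - b = 0 := by omega
          rw [this, Nat.zero_mod]
          left
          omega
        · rw [ι_ge l h']
          have hdpos := hd l h'
          have e : l.val + 1 - b = (l.val - b) + 1 := by omega
          rw [e, Nat.add_mod_eq_ite]
          have h2 := Nat.mod_lt (l.val - b) hdpos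
          by_cases hd1 : d = 1
          · subst hd1
            simp only [Nat.mod_one]
            right; left
            exact ⟨rfl, Or.inl (by simp)⟩
          · rw [Nat.mod_eq_of_lt (a := 1) (by omega)]
            split_ifs with h3
            · right; left
              exact ⟨by omega, Or.inl (by omega)⟩
            · left
              omega
  refine hasCIST_of_patterns (fun l => D (ι l)) (fun i => ⟨(γ i).val, by have := hγ i; omega⟩)
    (fun l => hv _) (fun l => hc _ _ (hsucc l)) (fun i l hli => hl i _ _ (hsucc l) ?_)
  intro e
  apply hli
  ext
  have h1 := hγ i
  have h2 : (ι l).val = (γ i).val := congrArg Fin.val e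
  by_cases h : l.val < b
  · exact (ι_lt l h).symm.trans h2
  · rw [ι_ge l h] at h2
    omega

/-- Two columns per colour (three for the last colour if `m` is odd): `⌊m / 2⌋` trees. The pointers
between two colours run around a four-cycle of each layer: they keep the parity of the column
towards the larger colour and switch it towards the smaller one. -/
lemma hasCIST_half (hm : 2 ≤ m) : HasCIST (completeBoxCycle m (n + 3)) (m / 2) := by
  set σ : LayerPattern m (m / 2) :=
    { color := fun a => ⟨min (a.val / 2) (m / 2 - 1), by omega⟩
      target := fun a i =>
        2 * i.val +
          if min (a.val / 2) (m / 2 - 1) < i.val then a.val % 2 else 1 - a.val % 2 } with hσ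
  have hlt : ∀ a i, σ.target a i < m := by
    intro a i
    simp only [hσ]
    split_ifs <;> omega
  refine hasCIST_of_patterns (fun _ => σ) (fun _ => 0) (fun _ => ?_) (fun _ => ⟨?_, ?_⟩) ?_
  · intro a i hi h
    have hi' : i.val ≠ min (a.val / 2) (m / 2 - 1) := fun e => hi (Fin.ext e)
    simp only [hσ]
    refine ⟨Fin.ext ?_, ?_⟩
    · dsimp only
      split_ifs <;> omega
    · split_ifs <;> omega
  · intro a i _ h
    exact absurd h (hlt a i).ne
  · intro a i _ h
    exact absurd h (hlt a i).le.not_gt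
  · intro i _ _
    refine ⟨⟨2 * i.val, by omega⟩, ?_, ?_⟩ <;>
    · ext
      simp only [hσ]
      omega

end Patterns

end CIST

namespace CIST

/-! ### Words for three, five, seven and nine columns -/

/-- The word for three columns and an odd number of layers: three letters and a block of two. -/
def patternsThreeThree : Fin (3 + 2) → LayerPattern 3 2 :=
  ![ ⟨![1, 1, 0],
      ![![2, 0], ![2, 1], ![2, 3]]⟩,
    ⟨![1, 0, 1],
      ![![1, 0], ![1, 2], ![3, 2]]⟩,
    ⟨![1, 0, 0],
      ![![1, 0], ![1, 3], ![2, 0]]⟩,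
    ⟨![1, 1, 0],
      ![![2, 0], ![3, 1], ![2, 1]]⟩,
    ⟨![1, 0, 0],
      ![![1, 0], ![1, 3], ![2, 0]]⟩]

lemma hasCIST_three_of_eq_three_add {n : ℕ} (q : ℕ) (hn : 3 + 2 * q = n + 3) :
    HasCIST (completeBoxCycle 3 (n + 3)) 2 :=
  hasCIST_of_word 3 2 q hn patternsThreeThree ![0, 0]
    (by decide) (by decide) (by decide) (by decide)

/-- The word for three columns and an even number of layers: two letters, and a block repeating
them. -/
def patternsThreeTwo : Fin (2 + 2) → LayerPattern 3 2 :=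
  ![ ⟨![1, 0, 1],
      ![![1, 0], ![1, 2], ![3, 2]]⟩,
    ⟨![1, 0, 0],
      ![![2, 0], ![1, 0], ![2, 3]]⟩,
    ⟨![1, 0, 1],
      ![![1, 0], ![1, 2], ![3, 2]]⟩,
    ⟨![1, 0, 0],
      ![![2, 0], ![1, 0], ![2, 3]]⟩]

lemma hasCIST_three_of_eq_two_add {n : ℕ} (q : ℕ) (hn : 2 + 2 * q = n + 3) :
    HasCIST (completeBoxCycle 3 (n + 3)) 2 :=
  hasCIST_of_word 2 2 q hn patternsThreeTwo ![0, 0]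
    (by decide) (by decide) (by decide) (by decide)

/-- The word for five columns and `3 + 3 q` layers. -/
def patternsFiveThree : Fin (3 + 3) → LayerPattern 5 3 :=
  ![ ⟨![0, 0, 1, 1, 2],
      ![![0, 3, 5], ![1, 2, 4], ![0, 2, 4], ![1, 3, 6], ![0, 3, 4]]⟩,
    ⟨![2, 0, 1, 0, 2],
      ![![1, 5, 0], ![1, 2, 4], ![3, 2, 0], ![3, 6, 0], ![3, 2, 4]]⟩,
    ⟨![1, 0, 1, 2, 2],
      ![![5, 0, 4], ![1, 0, 3], ![1, 2, 3], ![6, 0, 3], ![1, 2, 4]]⟩,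
    ⟨![0, 0, 1, 2, 1],
      ![![0, 4, 5], ![1, 2, 3], ![0, 2, 3], ![0, 4, 3], ![1, 4, 6]]⟩,
    ⟨![2, 0, 1, 2, 0],
      ![![1, 5, 0], ![1, 2, 3], ![4, 2, 0], ![4, 2, 3], ![4, 6, 0]]⟩,
    ⟨![1, 0, 1, 2, 2],
      ![![5, 0, 3], ![1, 0, 4], ![1, 2, 4], ![1, 2, 3], ![6, 0, 4]]⟩]

lemma hasCIST_five_of_eq_three_add {n : ℕ} (q : ℕ) (hn : 3 + 3 * q = n + 3) :
    HasCIST (completeBoxCycle 5 (n + 3)) 3 :=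
  hasCIST_of_word 3 3 q hn patternsFiveThree ![0, 0, 0]
    (by decide) (by decide) (by decide) (by decide)

/-- The word for five columns and `4 + 3 q` layers. -/
def patternsFiveFour : Fin (4 + 3) → LayerPattern 5 3 :=
  ![ ⟨![1, 1, 0, 2, 1],
      ![![5, 0, 6], ![2, 1, 3], ![2, 0, 5], ![2, 0, 3], ![2, 4, 3]]⟩,
    ⟨![0, 1, 2, 2, 0],
      ![![0, 1, 3], ![4, 1, 3], ![0, 1, 2], ![4, 5, 3], ![4, 6, 2]]⟩,
    ⟨![1, 1, 2, 1, 0],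
      ![![6, 0, 5], ![4, 1, 2], ![5, 0, 2], ![4, 3, 2], ![4, 0, 2]]⟩,
    ⟨![2, 1, 0, 2, 0],
      ![![4, 1, 0], ![4, 1, 3], ![2, 1, 0], ![2, 6, 3], ![4, 5, 3]]⟩,
    ⟨![0, 1, 0, 2, 1],
      ![![0, 4, 6], ![0, 1, 3], ![2, 1, 3], ![0, 4, 3], ![2, 4, 5]]⟩,
    ⟨![1, 1, 0, 2, 2],
      ![![6, 0, 3], ![2, 1, 4], ![2, 0, 4], ![2, 1, 3], ![5, 0, 4]]⟩,
    ⟨![2, 1, 0, 2, 0],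
      ![![4, 6, 0], ![4, 1, 0], ![2, 1, 0], ![2, 1, 3], ![4, 5, 3]]⟩]

lemma hasCIST_five_of_eq_four_add {n : ℕ} (q : ℕ) (hn : 4 + 3 * q = n + 3) :
    HasCIST (completeBoxCycle 5 (n + 3)) 3 :=
  hasCIST_of_word 4 3 q hn patternsFiveFour ![0, 0, 2]
    (by decide) (by decide) (by decide) (by decide)

/-- The word for five columns and `5 + 3 q` layers. -/
def patternsFiveFive : Fin (5 + 3) → LayerPattern 5 3 :=
  ![ ⟨![1, 1, 0, 0, 2],
      ![![3, 0, 5], ![2, 1, 4], ![2, 0, 6], ![3, 1, 4], ![2, 0, 4]]⟩,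
    ⟨![2, 1, 0, 2, 1],
      ![![2, 4, 0], ![5, 1, 0], ![2, 1, 3], ![6, 1, 3], ![2, 4, 3]]⟩,
    ⟨![0, 0, 0, 2, 1],
      ![![0, 4, 6], ![1, 4, 3], ![2, 5, 3], ![0, 4, 3], ![2, 4, 5]]⟩,
    ⟨![0, 1, 1, 2, 2],
      ![![0, 1, 3], ![6, 1, 4], ![0, 2, 3], ![5, 1, 3], ![0, 2, 4]]⟩,
    ⟨![0, 1, 2, 0, 2],
      ![![0, 5, 2], ![0, 1, 2], ![3, 6, 2], ![3, 1, 4], ![0, 1, 4]]⟩,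
    ⟨![1, 1, 0, 0, 2],
      ![![3, 0, 5], ![2, 1, 4], ![2, 0, 6], ![3, 1, 4], ![2, 0, 4]]⟩,
    ⟨![2, 1, 1, 0, 2],
      ![![5, 1, 0], ![3, 1, 4], ![6, 2, 0], ![3, 2, 0], ![3, 2, 4]]⟩,
    ⟨![0, 1, 2, 0, 2],
      ![![0, 5, 2], ![0, 1, 2], ![3, 6, 2], ![3, 1, 4], ![0, 1, 4]]⟩]

lemma hasCIST_five_of_eq_five_add {n : ℕ} (q : ℕ) (hn : 5 + 3 * q = n + 3) :
    HasCIST (completeBoxCycle 5 (n + 3)) 3 :=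
  hasCIST_of_word 5 3 q hn patternsFiveFive ![0, 2, 0]
    (by decide) (by decide) (by decide) (by decide)

/-- The word for seven columns and three layers. -/
def patternsSevenThree : Fin (3 + 0) → LayerPattern 7 4 :=
  ![ ⟨![2, 2, 0, 3, 0, 1, 3],
            ![![2, 5, 0, 6], ![4, 7, 1, 3], ![2, 5, 1, 3], ![4, 5, 0, 3], ![4, 5, 0, 6], ![7, 5,
        1, 6], ![2, 8, 1, 6]]⟩,
    ⟨![2, 1, 0, 3, 2, 0, 1],
            ![![2, 1, 0, 7], ![5, 1, 4, 3], ![2, 1, 4, 7], ![2, 6, 0, 3], ![5, 6, 4, 3], ![5, 6,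
        0, 3], ![2, 6, 0, 8]]⟩,
    ⟨![3, 2, 3, 3, 0, 1, 1],
            ![![4, 5, 7, 0], ![4, 8, 1, 0], ![7, 6, 1, 2], ![4, 5, 1, 3], ![4, 5, 8, 2], ![8, 5,
        1, 2], ![4, 6, 1, 0]]⟩]

lemma hasCIST_seven_three : HasCIST (completeBoxCycle 7 3) 4 :=
  hasCIST_of_word (n := 0) 3 0 0 rfl patternsSevenThree ![1, 0, 1, 0]
    (by decide) (by decide) (by decide) (by decide)

/-- The word for seven columns and four layers. -/
def patternsSevenFour : Fin (4 + 0) → LayerPattern 7 4 :=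
  ![ ⟨![1, 3, 1, 3, 0, 0, 2],
            ![![4, 0, 8, 1], ![5, 2, 6, 1], ![5, 2, 6, 3], ![4, 0, 6, 3], ![4, 2, 7, 1], ![5, 8,
        6, 3], ![4, 0, 6, 7]]⟩,
    ⟨![2, 3, 0, 1, 2, 0, 3],
            ![![5, 8, 0, 1], ![5, 3, 4, 1], ![2, 8, 0, 1], ![2, 3, 0, 8], ![2, 3, 4, 6], ![5, 3,
        4, 6], ![2, 3, 0, 6]]⟩,
    ⟨![2, 3, 2, 1, 0, 1, 3],
            ![![4, 5, 0, 1], ![7, 3, 2, 1], ![4, 3, 2, 6], ![4, 3, 0, 6], ![4, 5, 8, 1], ![8, 5,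
        2, 1], ![4, 5, 0, 6]]⟩,
    ⟨![2, 0, 1, 3, 0, 1, 2],
            ![![4, 2, 0, 3], ![1, 5, 0, 7], ![1, 2, 8, 3], ![1, 8, 6, 3], ![4, 2, 6, 3], ![4, 5,
        0, 3], ![1, 2, 6, 8]]⟩]

lemma hasCIST_seven_four : HasCIST (completeBoxCycle 7 4) 4 :=
  hasCIST_of_word (n := 1) 4 0 0 rfl patternsSevenFour ![1, 0, 0, 2]
    (by decide) (by decide) (by decide) (by decide)

/-- The word for nine columns and four layers. -/
def patternsNineFour : Fin (4 + 0) → LayerPattern 9 5 :=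
  ![ ⟨![3, 1, 1, 0, 4, 0, 3, 4, 2],
            ![![5, 2, 9, 0, 7], ![5, 1, 9, 0, 7], ![3, 2, 8, 6, 4], ![3, 1, 8, 0, 7], ![3, 1, 8,
        0, 4], ![5, 2, 10, 6, 4], ![3, 1, 8, 6, 4], ![5, 2, 8, 6, 7], ![5, 1, 8, 0, 9]]⟩,
    ⟨![2, 2, 1, 3, 4, 1, 3, 0, 4],
            ![![9, 2, 0, 6, 8], ![7, 5, 1, 3, 4], ![7, 2, 1, 3, 8], ![10, 5, 0, 3, 4], ![7, 2, 0,
        6, 4], ![10, 5, 0, 6, 4], ![7, 2, 1, 6, 8], ![7, 5, 0, 3, 10], ![7, 5, 1, 3, 8]]⟩,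
    ⟨![0, 2, 1, 3, 4, 3, 4, 0, 2],
            ![![0, 9, 8, 5, 6], ![0, 9, 1, 3, 4], ![0, 2, 1, 5, 9], ![0, 2, 8, 3, 6], ![0, 2, 8,
        3, 4], ![7, 10, 1, 5, 6], ![7, 2, 1, 10, 6], ![7, 2, 1, 3, 4], ![7, 2, 8, 5, 6]]⟩,
    ⟨![1, 1, 4, 0, 4, 2, 3, 0, 2],
            ![![3, 0, 5, 9, 2], ![7, 1, 8, 6, 2], ![3, 9, 5, 6, 2], ![3, 1, 8, 10, 4], ![7, 0, 8,
        6, 4], ![3, 1, 5, 10, 4], ![3, 0, 5, 6, 10], ![7, 0, 5, 6, 9], ![7, 0, 8, 6, 2]]⟩]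

lemma hasCIST_nine_four : HasCIST (completeBoxCycle 9 4) 5 :=
  hasCIST_of_word (n := 1) 4 0 0 rfl patternsNineFour ![0, 2, 0, 2, 0]
    (by decide) (by decide) (by decide) (by decide)

/-- The word for nine columns and five layers. -/
def patternsNineFive : Fin (5 + 0) → LayerPattern 9 5 :=
  ![ ⟨![3, 1, 2, 2, 0, 0, 4, 4, 1],
            ![![4, 1, 9, 0, 7], ![4, 1, 3, 9, 6], ![5, 1, 2, 0, 7], ![4, 8, 3, 0, 6], ![4, 8, 2,
        10, 7], ![5, 1, 3, 0, 6], ![4, 8, 2, 0, 6], ![5, 1, 3, 9, 7], ![5, 8, 2, 0, 7]]⟩,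
    ⟨![2, 3, 2, 1, 4, 0, 4, 3, 1],
            ![![9, 3, 0, 7, 4], ![5, 8, 0, 1, 4], ![5, 3, 2, 1, 6], ![5, 3, 10, 1, 4], ![10, 8, 2,
        7, 4], ![5, 9, 0, 7, 4], ![5, 3, 0, 1, 6], ![9, 3, 2, 7, 6], ![5, 8, 0, 7, 6]]⟩,
    ⟨![0, 3, 2, 4, 3, 1, 2, 0, 1],
            ![![0, 8, 2, 4, 3], ![0, 5, 2, 1, 3], ![7, 5, 2, 4, 3], ![7, 10, 6, 4, 3], ![7, 8, 6,
        4, 10], ![0, 5, 6, 4, 3], ![0, 8, 6, 1, 10], ![7, 5, 6, 1, 9], ![7, 8, 2, 1, 3]]⟩,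
    ⟨![0, 2, 0, 4, 3, 1, 1, 4, 3],
            ![![0, 5, 1, 4, 3], ![2, 6, 1, 10, 3], ![2, 6, 10, 8, 7], ![2, 6, 9, 4, 3], ![2, 5, 1,
        4, 7], ![2, 5, 1, 8, 3], ![0, 6, 10, 4, 7], ![0, 5, 1, 8, 7], ![0, 6, 1, 8, 3]]⟩,
    ⟨![3, 2, 0, 2, 3, 0, 4, 4, 1],
            ![![10, 8, 1, 0, 7], ![5, 9, 1, 4, 6], ![2, 8, 1, 0, 6], ![2, 8, 3, 0, 7], ![5, 8, 3,
        4, 6], ![5, 10, 3, 0, 7], ![5, 10, 3, 0, 6], ![2, 8, 1, 4, 7], ![5, 8, 1, 10, 6]]⟩]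

lemma hasCIST_nine_five : HasCIST (completeBoxCycle 9 5) 5 :=
  hasCIST_of_word (n := 2) 5 0 0 rfl patternsNineFive ![1, 3, 2, 0, 1]
    (by decide) (by decide) (by decide) (by decide)

end CIST

/-! ### Counting the edges at a colour class -/

namespace CIST

variable {V : Type*}

lemma sum_card_class {V : Type*} [Fintype V] {k : ℕ} (c : V → Fin k) :
    ∑ i, #{v | c v = i} = Fintype.card V := by
  classical
  rw [← card_univ]
  exact (card_eq_sum_card_fiberwise (f := c) (s := univ) (t := univ) (by simp)).symm

section Counting

variable [Fintype V] [DecidableEq V] {G : SimpleGraph V} {k : ℕ} {c : V → Fin k} {p : V → Fin k → V}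

/-- A clique of size `s` inside a colour class with `D` vertices forces `2 (D - s) + s (s - 1)`
ordered adjacent pairs in the class: every vertex outside the clique has an edge to its parent. -/
lemma IsCISTPartition.card_inner_darts [DecidableRel G.Adj] (h : IsCISTPartition G c p) {i : Fin k}
    {S : Finset V} (hS : ∀ v ∈ S, c v = i) (hne : S.Nonempty) (hclique : G.IsClique S) :
    2 * #{v | c v = i} + #S * #S ≤
      #{d : V × V | G.Adj d.1 d.2 ∧ c d.1 = i ∧ c d.2 = i} + 3 * #S := by
  obtain ⟨ρ, hρ⟩ := hne
  obtain ⟨f, ht, hf⟩ := exists_parent_toward (h.connected i) (hS ρ hρ)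
  set C : Finset V := {v | c v = i} with hC
  have hSC : S ⊆ C := fun v hv => by simpa [hC] using hS v hv
  have hf' : ∀ v ∈ C \ S, G.Adj v (f v) ∧ c (f v) = i ∧ ht (f v) < ht v := by
    intro v hv
    rw [mem_sdiff] at hv
    refine hf v (by simpa [hC] using hv.1) ?_
    rintro rfl
    exact hv.2 hρ
  set A₁ := (C \ S).image fun v => (v, f v) with hA₁
  set A₂ := (C \ S).image fun v => (f v, v) with hA₂
  have c₁ : #A₁ = #(C \ S) := card_image_of_injective _ fun a b hab => (Prod.ext_iff.1 hab).1
  have c₂ : #A₂ = #(C \ S) := card_image_of_injective _ fun a b hab => (Prod.ext_iff.1 hab).2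
  have hd₁ : Disjoint A₁ A₂ := by
    rw [Finset.disjoint_left]
    intro d h1 h2
    obtain ⟨v, hv, rfl⟩ := mem_image.1 h1
    obtain ⟨w, hw, e⟩ := mem_image.1 h2
    have e1 := (Prod.ext_iff.1 e).1
    have e2 := (Prod.ext_iff.1 e).2
    simp only at e1 e2
    have h3 := (hf' v hv).2.2
    have h4 := (hf' w hw).2.2
    rw [e1] at h4
    rw [← e2] at h3
    omega
  have hd₂ : Disjoint (A₁ ∪ A₂) S.offDiag := by
    rw [Finset.disjoint_left]
    intro d h1 h2
    rw [mem_offDiag] at h2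
    rcases mem_union.1 h1 with h1 | h1
    · obtain ⟨v, hv, rfl⟩ := mem_image.1 h1
      exact (mem_sdiff.1 hv).2 h2.1
    · obtain ⟨v, hv, rfl⟩ := mem_image.1 h1
      exact (mem_sdiff.1 hv).2 h2.2.1
  have hsub : (A₁ ∪ A₂) ∪ S.offDiag ⊆
      ({d : V × V | G.Adj d.1 d.2 ∧ c d.1 = i ∧ c d.2 = i} : Finset (V × V)) := by
    intro d hd
    rw [mem_filter]
    refine ⟨mem_univ _, ?_⟩
    rcases mem_union.1 hd with hd | hd
    · rcases mem_union.1 hd with hd | hd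
      · obtain ⟨v, hv, rfl⟩ := mem_image.1 hd
        exact ⟨(hf' v hv).1, by simpa [hC] using (mem_sdiff.1 hv).1, (hf' v hv).2.1⟩
      · obtain ⟨v, hv, rfl⟩ := mem_image.1 hd
        exact ⟨(hf' v hv).1.symm, (hf' v hv).2.1, by simpa [hC] using (mem_sdiff.1 hv).1⟩
    · rw [mem_offDiag] at hd
      exact ⟨hclique hd.1 hd.2.1 hd.2.2, hS _ hd.1, hS _ hd.2.1⟩
  have hcard := card_le_card hsub
  rw [card_union_of_disjoint hd₂, card_union_of_disjoint hd₁, c₁, c₂, offDiag_card] at hcard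
  have h5 : #(C \ S) + #S = #C := card_sdiff_add_card_eq_card hSC
  have h6 : #S ≤ #S * #S := Nat.le_mul_self _
  omega

/-- The pointers leaving and entering a colour class are pairwise distinct edges; `E` collects
edges leaving the class that are not pointers. -/
lemma IsCISTPartition.card_outer_darts [DecidableRel G.Adj] (h : IsCISTPartition G c p) {i : Fin k}
    {E : Finset (V × V)} (hE : ∀ d ∈ E, G.Adj d.1 d.2 ∧ c d.1 = i ∧ c d.2 ≠ i ∧
      p d.1 (c d.2) ≠ d.2 ∧ p d.2 i ≠ d.1) :
    k * #{v | c v = i} + Fintype.card V + #E ≤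
      #{d : V × V | G.Adj d.1 d.2 ∧ c d.1 = i ∧ c d.2 ≠ i} + 2 * #{v | c v = i} := by
  set C : Finset V := {v | c v = i} with hC
  set B₁ := (C ×ˢ (univ.erase i)).image fun x => (x.1, p x.1 x.2) with hB₁
  set B₂ := Cᶜ.image fun w => (p w i, w) with hB₂
  have m₁ : ∀ x ∈ C ×ˢ (univ.erase i), c x.1 = i ∧ x.2 ≠ i := by
    intro x hx
    rw [mem_product] at hx
    exact ⟨by simpa [hC] using hx.1, (mem_erase.1 hx.2).1⟩
  have m₂ : ∀ w ∈ Cᶜ, c w ≠ i := by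
    intro w hw
    simpa [hC] using hw
  have c₁ : #B₁ = #C * (k - 1) := by
    rw [hB₁, card_image_of_injOn, card_product, card_erase_of_mem (mem_univ _), card_univ,
      Fintype.card_fin]
    intro x hx y hy e
    have hx := m₁ x hx
    have hy := m₁ y hy
    have e1 := (Prod.ext_iff.1 e).1
    have e2 := (Prod.ext_iff.1 e).2
    simp only at e1 e2
    refine Prod.ext e1 ?_
    rw [← h.color x.1 x.2 (by rw [hx.1]; exact hx.2), e2,
      h.color y.1 y.2 (by rw [hy.1]; exact hy.2)]
  have c₂ : #B₂ = Fintype.card V - #C := by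
    rw [hB₂, card_image_of_injective _ fun a b hab => (Prod.ext_iff.1 hab).2, card_compl]
  have hd₁ : Disjoint B₁ B₂ := by
    rw [Finset.disjoint_left]
    intro d h1 h2
    obtain ⟨x, hx, rfl⟩ := mem_image.1 h1
    obtain ⟨w, hw, e⟩ := mem_image.1 h2
    have hx := m₁ x hx
    have e1 := (Prod.ext_iff.1 e).1
    have e2 := (Prod.ext_iff.1 e).2
    simp only at e1 e2
    refine h.asymm x.1 x.2 (by rw [hx.1]; exact hx.2) ?_
    rw [← e2, hx.1, e1]
  have hd₂ : Disjoint (B₁ ∪ B₂) E := by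
    rw [Finset.disjoint_left]
    intro d h1 h2
    obtain ⟨-, -, -, h3, h4⟩ := hE d h2
    rcases mem_union.1 h1 with h1 | h1
    · obtain ⟨x, hx, rfl⟩ := mem_image.1 h1
      have hx := m₁ x hx
      simp only at h3
      rw [h.color x.1 x.2 (by rw [hx.1]; exact hx.2)] at h3
      exact h3 rfl
    · obtain ⟨v, hv, rfl⟩ := mem_image.1 h1
      exact h4 rfl
  have hsub : (B₁ ∪ B₂) ∪ E ⊆
      ({d : V × V | G.Adj d.1 d.2 ∧ c d.1 = i ∧ c d.2 ≠ i} : Finset (V × V)) := by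
    intro d hd
    rw [mem_filter]
    refine ⟨mem_univ _, ?_⟩
    rcases mem_union.1 hd with hd | hd
    · rcases mem_union.1 hd with hd | hd
      · obtain ⟨x, hx, rfl⟩ := mem_image.1 hd
        have hx := m₁ x hx
        have hi : x.2 ≠ c x.1 := by rw [hx.1]; exact hx.2
        exact ⟨h.adj _ _ hi, hx.1, by rw [h.color _ _ hi]; exact hx.2⟩
      · obtain ⟨w, hw, rfl⟩ := mem_image.1 hd
        have hi : i ≠ c w := (m₂ w hw).symm
        exact ⟨(h.adj _ _ hi).symm, h.color _ _ hi, m₂ w hw⟩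
    · obtain ⟨h1, h2, h3, -⟩ := hE d hd
      exact ⟨h1, h2, h3⟩
  have hcard := card_le_card hsub
  rw [card_union_of_disjoint hd₂, card_union_of_disjoint hd₁, c₁, c₂] at hcard
  have h5 : #C ≤ Fintype.card V := card_le_univ C
  obtain ⟨k, rfl⟩ : ∃ k', k = k' + 1 := ⟨k - 1, by have := i.2; omega⟩
  rw [Nat.add_sub_cancel] at hcard
  have : (k + 1) * #C = #C * k + #C := by ring
  omega

/-- The edge count that drives the non-existence proof, for a `2k`-regular graph on `N` vertices
with a partition into `k` colours: a class of size `D` containing a clique of size `s` and incident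
with `e` outgoing edges that are not pointers satisfies `N + s² + e ≤ k D + 3 s`. -/
lemma IsCISTPartition.card_class_ge [DecidableRel G.Adj] (h : IsCISTPartition G c p)
    (hreg : ∀ v, G.degree v = 2 * k) {i : Fin k}
    {S : Finset V} (hS : ∀ v ∈ S, c v = i) (hne : S.Nonempty) (hclique : G.IsClique S)
    {E : Finset (V × V)} (hE : ∀ d ∈ E, G.Adj d.1 d.2 ∧ c d.1 = i ∧ c d.2 ≠ i ∧
      p d.1 (c d.2) ≠ d.2 ∧ p d.2 i ≠ d.1) :
    Fintype.card V + #S * #S + #E ≤ k * #{v | c v = i} + 3 * #S := by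
  have h1 := h.card_inner_darts hS hne hclique
  have h2 := h.card_outer_darts hE
  have h3 : #{d : V × V | G.Adj d.1 d.2 ∧ c d.1 = i} = 2 * k * #{v | c v = i} := by
    have : ({d : V × V | G.Adj d.1 d.2 ∧ c d.1 = i} : Finset (V × V)) =
        ({v | c v = i} : Finset V).biUnion fun v => (G.neighborFinset v).image fun w => (v, w) := by
      ext ⟨v, w⟩
      simp only [mem_filter, mem_univ, true_and, mem_biUnion, mem_image, Prod.mk.injEq,
        SimpleGraph.mem_neighborFinset]
      constructor
      · rintro ⟨h1, h2⟩
        exact ⟨v, h2, w, h1, rfl, rfl⟩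
      · rintro ⟨v, h1, w, h2, rfl, rfl⟩
        exact ⟨h2, h1⟩
    rw [this, card_biUnion]
    · have : ∀ v, #((G.neighborFinset v).image fun w => (v, w)) = 2 * k := fun v => by
        rw [card_image_of_injective _ fun a b hab => (Prod.ext_iff.1 hab).2,
          SimpleGraph.card_neighborFinset_eq_degree, hreg]
      simp only [this, sum_const, smul_eq_mul]
      ring
    · intro v _ w _ hvw
      rw [Function.onFun, Finset.disjoint_left]
      intro d h1 h2
      obtain ⟨x, -, rfl⟩ := mem_image.1 h1
      obtain ⟨y, -, e⟩ := mem_image.1 h2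
      exact hvw (Prod.ext_iff.1 e).1.symm
  have h4 := card_filter_add_card_filter_not
    (s := ({d : V × V | G.Adj d.1 d.2 ∧ c d.1 = i} : Finset (V × V))) (fun d => c d.2 = i)
  rw [filter_filter, filter_filter, h3] at h4
  simp only [and_assoc] at h4
  have h4' : #{d : V × V | G.Adj d.1 d.2 ∧ c d.1 = i ∧ c d.2 = i} +
      #{d : V × V | G.Adj d.1 d.2 ∧ c d.1 = i ∧ c d.2 ≠ i} = 2 * k * #{v | c v = i} := by
    convert h4
  have h5 : 2 * k * #{v | c v = i} = 2 * (k * #{v | c v = i}) := by ring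
  omega

end Counting

end CIST

/-! ### Non-existence -/

namespace CIST

section Nonexistence

variable {m n k : ℕ} {c : Fin m × Fin (n + 3) → Fin k}
  {p : Fin m × Fin (n + 3) → Fin k → Fin m × Fin (n + 3)}

/-- The columns in which the layer `l` has colour `i`. -/
def layerColumns (c : Fin m × Fin (n + 3) → Fin k) (i : Fin k) (l : Fin (n + 3)) :
    Finset (Fin m) :=
  {a | c (a, l) = i}

@[simp] lemma mem_layerColumns {i : Fin k} {l : Fin (n + 3)} {a : Fin m} :
    a ∈ layerColumns c i l ↔ c (a, l) = i := by
  simp [layerColumns]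

lemma sum_card_layerColumns (c : Fin m × Fin (n + 3) → Fin k) (i : Fin k) :
    ∑ l, #(layerColumns c i l) = #{v | c v = i} := by
  rw [card_eq_sum_card_fiberwise (f := Prod.snd) (t := univ) (by simp)]
  refine sum_congr rfl fun l _ => ?_
  refine card_bij (fun a _ => (a, l)) (fun a ha => ?_) (fun a _ b _ e => (Prod.ext_iff.1 e).1) ?_
  · simpa using ha
  · rintro ⟨a, l'⟩ hv
    simp only [mem_filter, mem_univ, true_and] at hv
    obtain ⟨h1, rfl⟩ := hv
    exact ⟨a, by simpa using h1, rfl⟩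

lemma IsCISTPartition.pointer_cases (h : IsCISTPartition (completeBoxCycle m (n + 3)) c p)
    {a : Fin m} {l : Fin (n + 3)} {i : Fin k} (hi : i ≠ c (a, l)) :
    (∃ b, p (a, l) i = (b, l) ∧ c (b, l) = i) ∨
      (p (a, l) i = (a, l + 1) ∧ c (a, l + 1) = i) ∨
      (p (a, l) i = (a, l - 1) ∧ c (a, l - 1) = i) := by
  have h1 := h.adj _ _ hi
  have h2 := h.color _ _ hi
  set w := p (a, l) i with hw
  obtain ⟨b, l'⟩ := w
  rcases completeBoxCycle_adj.1 h1 with ⟨e, -⟩ | ⟨e, e' | e'⟩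
  · obtain rfl : l = l' := e
    exact Or.inl ⟨b, rfl, h2⟩
  · obtain rfl : a = b := e
    obtain rfl : l' = l + 1 := e'
    exact Or.inr (Or.inl ⟨rfl, h2⟩)
  · obtain rfl : a = b := e
    obtain rfl : l' = l - 1 := eq_sub_of_add_eq e'.symm
    exact Or.inr (Or.inr ⟨rfl, h2⟩)

/-- If the layer `l` has a single vertex of colour `i`, in the column `α`, then every other colour
`j` is met by an edge from the class of `i` that enters or leaves the layer `l` vertically.
Otherwise the edges between `i` and `j` at this layer would form a star, with one edge too few. -/
lemma IsCISTPartition.color_near_singleton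
    (h : IsCISTPartition (completeBoxCycle m (n + 3)) c p) {i j : Fin k} {l : Fin (n + 3)}
    {α : Fin m} (hα : layerColumns c i l = {α}) (hj : j ≠ i) :
    (c (α, l + 1) = j ∨ ∃ b, c (b, l + 1) = i ∧ c (b, l) = j) ∨
      (c (α, l - 1) = j ∨ ∃ b, c (b, l - 1) = i ∧ c (b, l) = j) := by
  have hc : c (α, l) = i := by rw [← mem_layerColumns, hα]; simp
  rcases h.pointer_cases (a := α) (l := l) (i := j) (by rw [hc]; exact hj) with
    ⟨b, hb, hbj⟩ | ⟨-, e⟩ | ⟨-, e⟩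
  · rcases h.pointer_cases (a := b) (l := l) (i := i) (by rw [hbj]; exact hj.symm) with
      ⟨b', hb', hbi⟩ | ⟨-, e⟩ | ⟨-, e⟩
    · rw [← mem_layerColumns, hα, mem_singleton] at hbi
      refine absurd ?_ (h.asymm (α, l) j (by rw [hc]; exact hj))
      rw [hb, hc, hb', hbi]
    · exact Or.inl (Or.inr ⟨b, e, hbj⟩)
    · exact Or.inr (Or.inr ⟨b, e, hbj⟩)
  · exact Or.inl (Or.inl e)
  · exact Or.inr (Or.inl e)

/-- The number of foreign colours met by the vertical edges between the class of `i` and a layer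
with single vertex `(α, l)`, on the side of the layer `l'`: linking uses up edges on this side. -/
lemma card_side_colors_le {i : Fin k} {l l' : Fin (n + 3)} {α : Fin m}
    (hα : layerColumns c i l = {α}) {J : Finset (Fin k)}
    (hJ : ∀ j ∈ J, j ≠ i ∧ (c (α, l') = j ∨ ∃ b, c (b, l') = i ∧ c (b, l) = j)) :
    (c (α, l') = i → #J + 1 ≤ #(layerColumns c i l')) ∧
      #J ≤ #(layerColumns c i l') + 1 := by
  have hc : c (α, l) = i := by rw [← mem_layerColumns, hα]; simp
  constructor
  · intro h
    have hsub : J ⊆ ((layerColumns c i l').erase α).image fun b => c (b, l) := by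
      intro j hj
      obtain ⟨hji, h' | ⟨b, hb, hbj⟩⟩ := hJ j hj
      · exact absurd (h'.symm.trans h) hji
      · refine mem_image.2 ⟨b, mem_erase.2 ⟨?_, mem_layerColumns.2 hb⟩, hbj⟩
        rintro rfl
        exact hji (hbj.symm.trans hc)
    have h1 := (card_le_card hsub).trans card_image_le
    have h2 : α ∈ layerColumns c i l' := mem_layerColumns.2 h
    rw [card_erase_of_mem h2] at h1
    have := card_pos.2 ⟨α, h2⟩
    omega
  · have hsub : J ⊆ insert (c (α, l')) ((layerColumns c i l').image fun b => c (b, l)) := by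
      intro j hj
      obtain ⟨-, h' | ⟨b, hb, hbj⟩⟩ := hJ j hj
      · exact mem_insert.2 (Or.inl h'.symm)
      · exact mem_insert_of_mem (mem_image.2 ⟨b, mem_layerColumns.2 hb, hbj⟩)
    exact (card_le_card hsub).trans ((card_insert_le _ _).trans (by gcongr; exact card_image_le))

lemma linked_class_iff_of_singleton {i : Fin k} {l : Fin (n + 3)} {α : Fin m}
    (hα : layerColumns c i l = {α}) : Linked {v | c v = i} l ↔ c (α, l + 1) = i := by
  constructor
  · rintro ⟨a, h1, h2⟩
    have h1 : a ∈ layerColumns c i l := mem_layerColumns.2 h1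
    rw [hα, mem_singleton] at h1
    exact h1 ▸ h2
  · intro h
    exact ⟨α, by rw [Set.mem_ofPred_eq, ← mem_layerColumns, hα]; simp, h⟩

lemma linked_class_sub_one_iff_of_singleton {i : Fin k} {l : Fin (n + 3)} {α : Fin m}
    (hα : layerColumns c i l = {α}) : Linked {v | c v = i} (l - 1) ↔ c (α, l - 1) = i := by
  constructor
  · rintro ⟨a, h1, h2⟩
    rw [sub_add_cancel] at h2
    have h2 : a ∈ layerColumns c i l := mem_layerColumns.2 h2
    rw [hα, mem_singleton] at h2
    exact h2 ▸ h1
  · intro h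
    refine ⟨α, h, ?_⟩
    rw [sub_add_cancel, Set.mem_ofPred_eq, ← mem_layerColumns, hα]
    simp

/-- A class with one or two vertices in every layer: at a layer with one vertex, exactly one of the
two neighbouring layers is linked to it, and there are few colours in total. -/
lemma IsCISTPartition.singleton_layer
    (h : IsCISTPartition (completeBoxCycle m (n + 3)) c p) (hk : 4 ≤ k) {i : Fin k}
    (h1 : ∀ l, 1 ≤ #(layerColumns c i l)) (h2 : ∀ l, #(layerColumns c i l) ≤ 2)
    {l : Fin (n + 3)} {α : Fin m} (hα : layerColumns c i l = {α}) :
    ((c (α, l + 1) ≠ i ∧ c (α, l - 1) = i) ∨ (c (α, l + 1) = i ∧ c (α, l - 1) ≠ i)) ∧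
      k ≤ #(layerColumns c i (l + 1)) + #(layerColumns c i (l - 1)) + 1 := by
  classical
  set J₁ : Finset (Fin k) :=
    {j | j ≠ i ∧ (c (α, l + 1) = j ∨ ∃ b, c (b, l + 1) = i ∧ c (b, l) = j)} with hJ₁
  set J₂ : Finset (Fin k) :=
    {j | j ≠ i ∧ (c (α, l - 1) = j ∨ ∃ b, c (b, l - 1) = i ∧ c (b, l) = j)} with hJ₂
  have hcover : univ.erase i ⊆ J₁ ∪ J₂ := by
    intro j hj
    have hji := (mem_erase.1 hj).1
    rw [mem_union, hJ₁, hJ₂, mem_filter, mem_filter]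
    rcases h.color_near_singleton hα hji with e | e
    · exact Or.inl ⟨mem_univ _, hji, e⟩
    · exact Or.inr ⟨mem_univ _, hji, e⟩
  have hcard := (card_le_card hcover).trans (card_union_le _ _)
  rw [card_erase_of_mem (mem_univ _), card_univ, Fintype.card_fin] at hcard
  obtain ⟨a1, a2⟩ := card_side_colors_le hα (J := J₁) (l' := l + 1) (by simp [hJ₁])
  obtain ⟨b1, b2⟩ := card_side_colors_le hα (J := J₂) (l' := l - 1) (by simp [hJ₂])
  have u1 := h2 (l + 1)
  have u2 := h2 (l - 1)
  have hgap : ¬ (c (α, l + 1) ≠ i ∧ c (α, l - 1) ≠ i) := by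
    rintro ⟨e1, e2⟩
    have hlayer : ∀ l, ∃ a, (a, l) ∈ {v | c v = i} := fun l => by
      obtain ⟨a, ha⟩ := card_pos.1 (h1 l)
      exact ⟨a, mem_layerColumns.1 ha⟩
    have := eq_of_not_linked (h.connected i) hlayer
      (mt (linked_class_iff_of_singleton hα).1 e1)
      (mt (linked_class_sub_one_iff_of_singleton hα).1 e2)
    exact layer_add_one_ne (l - 1) (by rw [sub_add_cancel]; exact this)
  by_cases e1 : c (α, l + 1) = i <;> by_cases e2 : c (α, l - 1) = i
  · have := a1 e1
    have := b1 e2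
    omega
  · have := a1 e1
    exact ⟨Or.inr ⟨e1, e2⟩, by omega⟩
  · have := b1 e2
    exact ⟨Or.inl ⟨e1, e2⟩, by omega⟩
  · exact absurd ⟨e1, e2⟩ hgap

lemma exists_subset_pair_of_card_le_two {β : Type*} [DecidableEq β] {A : Finset β} {a : β}
    (hA : #A ≤ 2) (ha : a ∈ A) : ∃ b, A ⊆ {a, b} := by
  have h1 : #(A.erase a) ≤ 1 := by rw [card_erase_of_mem ha]; omega
  rcases (A.erase a).eq_empty_or_nonempty with e | ⟨b, hb⟩
  · refine ⟨a, fun x hx => ?_⟩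
    by_contra hne
    have : x ∈ A.erase a := mem_erase.2 ⟨fun e => hne (by simp [e]), hx⟩
    simp [e] at this
  · refine ⟨b, fun x hx => ?_⟩
    by_cases e : x = a
    · simp [e]
    · have := card_le_one.1 h1 x (mem_erase.2 ⟨e, hx⟩) b hb
      simp [this]

/-- If three colours cover all colours other than `i`, then the first of them is none of `i` and the
two others. -/
lemma three_colors_distinct {i x y z : Fin k} (hk : 4 ≤ k)
    (h : univ.erase i ⊆ ({x, y, z} : Finset (Fin k))) :
    x ≠ i ∧ x ≠ y ∧ x ≠ z := by
  have hc := card_le_card h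
  rw [card_erase_of_mem (mem_univ _), card_univ, Fintype.card_fin] at hc
  refine ⟨?_, ?_, ?_⟩
  · rintro rfl
    have h' : univ.erase x ⊆ ({y, z} : Finset (Fin k)) := by
      intro w hw
      have := h hw
      have hne := (mem_erase.1 hw).1
      simpa [hne] using this
    have := card_le_card h'
    rw [card_erase_of_mem (mem_univ _), card_univ, Fintype.card_fin] at this
    have : #({y, z} : Finset (Fin k)) ≤ 2 := card_le_two
    omega
  · rintro rfl
    rw [insert_idem] at hc
    have : #({x, z} : Finset (Fin k)) ≤ 2 := card_le_two
    omega
  · rintro rfl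
    have e : ({x, y, x} : Finset (Fin k)) = {x, y} := by ext w; simp; tauto
    rw [e] at hc
    have : #({x, y} : Finset (Fin k)) ≤ 2 := card_le_two
    omega

/-- A class with one or two vertices in every layer cannot have single vertices in two consecutive
layers that are not linked. The colour `j` above the lower single vertex would meet the class, near
these two layers, in two stars joined by one edge, which is a tree. -/
lemma IsCISTPartition.no_unlinked_singletons
    (h : IsCISTPartition (completeBoxCycle m (n + 3)) c p) (hk : 4 ≤ k) {i : Fin k}
    (h1 : ∀ l, 1 ≤ #(layerColumns c i l)) (h2 : ∀ l, #(layerColumns c i l) ≤ 2)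
    {g : Fin (n + 3)} {α β : Fin m} (hα : layerColumns c i g = {α})
    (hβ : layerColumns c i (g + 1) = {β}) (hg : c (α, g + 1) ≠ i) : False := by
  have cα : c (α, g) = i := by rw [← mem_layerColumns, hα]; simp
  have cβ : c (β, g + 1) = i := by rw [← mem_layerColumns, hβ]; simp
  have hβg : c (β, g) ≠ i := by
    intro e
    rw [← mem_layerColumns, hα, mem_singleton] at e
    exact hg (e ▸ cβ)
  have eα : c (α, g - 1) = i := by
    rcases (h.singleton_layer hk h1 h2 hα).1 with e | e
    · exact e.2
    · exact absurd e.1 hg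
  have eβ : c (β, g + 1 + 1) = i := by
    rcases (h.singleton_layer hk h1 h2 hβ).1 with e | e
    · rw [add_sub_cancel_right] at e
      exact absurd e.2 hβg
    · exact e.1
  obtain ⟨γ, hγ⟩ := exists_subset_pair_of_card_le_two (h2 (g - 1)) (mem_layerColumns.2 eα)
  obtain ⟨δ, hδ⟩ := exists_subset_pair_of_card_le_two (h2 (g + 1 + 1)) (mem_layerColumns.2 eβ)
  have inα : ∀ {b}, c (b, g) = i → b = α := fun {b} hb => by
    rw [← mem_layerColumns, hα, mem_singleton] at hb; exact hb
  have inβ : ∀ {b}, c (b, g + 1) = i → b = β := fun {b} hb => by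
    rw [← mem_layerColumns, hβ, mem_singleton] at hb; exact hb
  have inγ : ∀ {b}, c (b, g - 1) = i → b = α ∨ b = γ := fun {b} hb => by
    simpa using hγ (mem_layerColumns.2 hb)
  have inδ : ∀ {b}, c (b, g + 1 + 1) = i → b = β ∨ b = δ := fun {b} hb => by
    simpa using hδ (mem_layerColumns.2 hb)
  have cover₁ : univ.erase i ⊆ ({c (α, g + 1), c (β, g), c (γ, g)} : Finset (Fin k)) := by
    intro j hj
    have hji := (mem_erase.1 hj).1
    simp only [mem_insert, mem_singleton]
    rcases h.color_near_singleton hα hji with (e | ⟨b, hb, e⟩) | (e | ⟨b, hb, e⟩)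
    · exact Or.inl e.symm
    · rw [inβ hb] at e; exact Or.inr (Or.inl e.symm)
    · exact absurd (e.symm.trans eα) hji
    · rcases inγ hb with rfl | rfl
      · exact absurd (e.symm.trans cα) hji
      · exact Or.inr (Or.inr e.symm)
  have cover₂ : univ.erase i ⊆ ({c (α, g + 1), c (β, g), c (δ, g + 1)} : Finset (Fin k)) := by
    intro j hj
    have hji := (mem_erase.1 hj).1
    simp only [mem_insert, mem_singleton]
    rcases h.color_near_singleton hβ hji with (e | ⟨b, hb, e⟩) | (e | ⟨b, hb, e⟩)
    · exact absurd (e.symm.trans eβ) hji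
    · rcases inδ hb with rfl | rfl
      · exact absurd (e.symm.trans cβ) hji
      · exact Or.inr (Or.inr e.symm)
    · rw [add_sub_cancel_right] at e; exact Or.inr (Or.inl e.symm)
    · rw [add_sub_cancel_right] at hb
      rw [inα hb] at e; exact Or.inl e.symm
  obtain ⟨hji, hjβ, hjγ⟩ := three_colors_distinct hk cover₁
  obtain ⟨-, -, hjδ⟩ := three_colors_distinct hk cover₂
  set j := c (α, g + 1) with hj
  -- all vertices of colour `j` in the layer `g` point at the single vertex `(α, g)`
  have star₁ : ∀ b, c (b, g) = j → p (b, g) i = (α, g) := by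
    intro b hb
    rcases h.pointer_cases (a := b) (l := g) (i := i) (by rw [hb]; exact hji.symm) with
      ⟨b', e, e'⟩ | ⟨-, e⟩ | ⟨-, e⟩
    · rw [e, inα e']
    · rw [inβ e] at hb; exact absurd hb.symm hjβ
    · rcases inγ e with rfl | rfl
      · exact absurd (hb.symm.trans cα) hji
      · exact absurd hb.symm hjγ
  have hi₁ : j ≠ c (α, g) := by rw [cα]; exact hji
  have up : p (α, g) j = (α, g + 1) := by
    rcases h.pointer_cases hi₁ with ⟨b, e, e'⟩ | ⟨e, -⟩ | ⟨-, e⟩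
    · refine absurd ?_ (h.asymm _ _ hi₁)
      rw [e, cα, star₁ b e']
    · exact e
    · exact absurd (e.symm.trans eα) hji
  have up' : p (α, g + 1) i ≠ (α, g) := by
    have := h.asymm _ _ hi₁
    rwa [up, cα] at this
  -- all vertices of colour `j` in the layer `g + 1` point at the single vertex `(β, g + 1)`
  have star₂ : ∀ b, c (b, g + 1) = j → p (b, g + 1) i = (β, g + 1) := by
    intro b hb
    rcases h.pointer_cases (a := b) (l := g + 1) (i := i) (by rw [hb]; exact hji.symm) with
      ⟨b', e, e'⟩ | ⟨-, e⟩ | ⟨e, e'⟩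
    · rw [e, inβ e']
    · rcases inδ e with rfl | rfl
      · exact absurd (hb.symm.trans cβ) hji
      · exact absurd hb.symm hjδ
    · rw [add_sub_cancel_right] at e e'
      rw [inα e'] at e
      exact absurd e up'
  have hi₂ : j ≠ c (β, g + 1) := by rw [cβ]; exact hji
  rcases h.pointer_cases hi₂ with ⟨b, e, e'⟩ | ⟨-, e⟩ | ⟨-, e⟩
  · refine h.asymm _ _ hi₂ ?_
    rw [e, cβ, star₂ b e']
  · exact hji (e.symm.trans eβ)
  · rw [add_sub_cancel_right] at e
    exact hjβ e.symm

/-- On three layers, the layer with a single vertex of the class sees at most three other colours: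
the two other layers are linked to each other, which wastes one of the vertical edges. -/
lemma IsCISTPartition.le_four_of_three_layers {c : Fin m × Fin 3 → Fin k}
    {p : Fin m × Fin 3 → Fin k → Fin m × Fin 3}
    (h : IsCISTPartition (completeBoxCycle m 3) c p) (hk : 4 ≤ k) {i : Fin k}
    (h1 : ∀ l, 1 ≤ #(layerColumns (n := 0) c i l)) (h2 : ∀ l, #(layerColumns (n := 0) c i l) ≤ 2)
    {l : Fin 3} {α : Fin m} (hα : layerColumns (n := 0) c i l = {α}) : k ≤ 4 := by
  have cα : c (α, l) = i := by rw [← mem_layerColumns (n := 0), hα]; simp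
  have hlayer : ∀ l, ∃ a, (a, l) ∈ {v | c v = i} := fun l => by
    obtain ⟨a, ha⟩ := card_pos.1 (h1 l)
    exact ⟨a, (mem_layerColumns (n := 0)).1 ha⟩
  have e3 : ∀ l : Fin 3, l + 1 + 1 = l - 1 := by decide
  have key : ∃ lu ld β, c (α, lu) ≠ i ∧ c (α, ld) = i ∧ (∀ b, c (b, ld) = i → b = α ∨ b = β) ∧
      c (β, lu) = i ∧ ((lu = l + 1 ∧ ld = l - 1) ∨ (lu = l - 1 ∧ ld = l + 1)) := by
    rcases (h.singleton_layer (n := 0) hk h1 h2 hα).1 with ⟨e1, e2⟩ | ⟨e1, e2⟩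
    · obtain ⟨β, hβ⟩ := exists_subset_pair_of_card_le_two (h2 (l - 1))
        ((mem_layerColumns (n := 0)).2 e2)
      have hin : ∀ b, c (b, l - 1) = i → b = α ∨ b = β := fun b hb => by
        simpa using hβ ((mem_layerColumns (n := 0)).2 hb)
      have hlink : Linked (n := 0) {v | c v = i} (l + 1) := by
        by_contra hcon
        exact layer_add_one_ne (n := 0) l (eq_of_not_linked (n := 0) (h.connected i) hlayer hcon
          (mt (linked_class_iff_of_singleton (n := 0) hα).1 e1))
      obtain ⟨x, hx, hx'⟩ := hlink
      rw [e3 l] at hx'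
      refine ⟨l + 1, l - 1, β, e1, e2, hin, ?_, Or.inl ⟨rfl, rfl⟩⟩
      rcases hin x hx' with rfl | rfl
      · exact absurd hx e1
      · exact hx
    · obtain ⟨β, hβ⟩ := exists_subset_pair_of_card_le_two (h2 (l + 1))
        ((mem_layerColumns (n := 0)).2 e1)
      have hin : ∀ b, c (b, l + 1) = i → b = α ∨ b = β := fun b hb => by
        simpa using hβ ((mem_layerColumns (n := 0)).2 hb)
      have hlink : Linked (n := 0) {v | c v = i} (l + 1) := by
        by_contra hcon
        have := eq_of_not_linked (n := 0) (h.connected i) hlayer hcon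
          (mt (linked_class_sub_one_iff_of_singleton (n := 0) hα).1 e2)
        exact layer_add_two_ne (n := 0) (l - 1) (by rw [sub_add_cancel]; exact this)
      obtain ⟨x, hx, hx'⟩ := hlink
      rw [e3 l] at hx'
      refine ⟨l - 1, l + 1, β, e2, e1, hin, ?_, Or.inr ⟨rfl, rfl⟩⟩
      rcases hin x hx with rfl | rfl
      · exact absurd hx' e2
      · exact hx'
  obtain ⟨lu, ld, β, hu, hd, hin, hβ, hside⟩ := key
  obtain ⟨δ, hδ⟩ := exists_subset_pair_of_card_le_two (h2 lu) ((mem_layerColumns (n := 0)).2 hβ)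
  have cover : univ.erase i ⊆ ({c (α, lu), c (β, l), c (δ, l)} : Finset (Fin k)) := by
    intro j hj
    have hji := (mem_erase.1 hj).1
    simp only [mem_insert, mem_singleton]
    have hsplit : (c (α, lu) = j ∨ ∃ b, c (b, lu) = i ∧ c (b, l) = j) ∨
        (c (α, ld) = j ∨ ∃ b, c (b, ld) = i ∧ c (b, l) = j) := by
      rcases hside with ⟨rfl, rfl⟩ | ⟨rfl, rfl⟩
      · exact h.color_near_singleton (n := 0) hα hji
      · exact (h.color_near_singleton (n := 0) hα hji).symm
    rcases hsplit with (e | ⟨b, hb, e⟩) | (e | ⟨b, hb, e⟩)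
    · exact Or.inl e.symm
    · have : b = β ∨ b = δ := by simpa using hδ ((mem_layerColumns (n := 0)).2 hb)
      rcases this with rfl | rfl
      · exact Or.inr (Or.inl e.symm)
      · exact Or.inr (Or.inr e.symm)
    · exact absurd (e.symm.trans hd) hji
    · rcases hin b hb with rfl | rfl
      · exact absurd (e.symm.trans cα) hji
      · exact Or.inr (Or.inl e.symm)
  have hc := (card_le_card cover).trans card_le_three
  rw [card_erase_of_mem (mem_univ _), card_univ, Fintype.card_fin] at hc
  omega

/-- A class of at most average size has one or two vertices in every layer. -/
lemma IsCISTPartition.card_layerColumns_of_small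
    (h : IsCISTPartition (completeBoxCycle m (n + 3)) c p) (hk : 4 ≤ k) (hm : m + 1 = 2 * k)
    {i : Fin k} (hi : k * #{v | c v = i} ≤ m * (n + 3)) :
    (∀ l, 1 ≤ #(layerColumns c i l) ∧ #(layerColumns c i l) ≤ 2) ∧
      m * (n + 3) ≤ k * #{v | c v = i} + 2 := by
  classical
  have hN : Fintype.card (Fin m × Fin (n + 3)) = m * (n + 3) := by simp
  set S : Fin (n + 3) → Finset (Fin m × Fin (n + 3)) :=
    fun l => (layerColumns c i l).image fun a => (a, l) with hS
  have memS : ∀ {l v}, v ∈ S l ↔ c v = i ∧ v.2 = l := by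
    rintro l ⟨a, l'⟩
    simp only [hS, mem_image, mem_layerColumns, Prod.mk.injEq]
    constructor
    · rintro ⟨b, hb, rfl, rfl⟩
      exact ⟨hb, rfl⟩
    · rintro ⟨hb, rfl⟩
      exact ⟨a, hb, rfl, rfl⟩
  have cardS : ∀ l, #(S l) = #(layerColumns c i l) := fun l =>
    card_image_of_injective _ fun a b hab => (Prod.ext_iff.1 hab).1
  have hclique : ∀ l, (completeBoxCycle m (n + 3)).IsClique (S l) := by
    intro l u hu v hv huv
    rw [mem_coe, memS] at hu hv
    have e : u.2 = v.2 := hu.2.trans hv.2.symm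
    exact completeBoxCycle_adj.2 (Or.inl ⟨e, fun e' => huv (Prod.ext e' e)⟩)
  have bound : ∀ l, (S l).Nonempty → ∀ E : Finset ((Fin m × Fin (n + 3)) × (Fin m × Fin (n + 3))),
      (∀ d ∈ E, (completeBoxCycle m (n + 3)).Adj d.1 d.2 ∧ c d.1 = i ∧ c d.2 ≠ i ∧
        p d.1 (c d.2) ≠ d.2 ∧ p d.2 i ≠ d.1) →
      m * (n + 3) + #(layerColumns c i l) * #(layerColumns c i l) + #E ≤
        k * #{v | c v = i} + 3 * #(layerColumns c i l) := by
    intro l hne E hE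
    have := h.card_class_ge (fun v => by rw [completeBoxCycle_degree]; omega)
      (fun v hv => (memS.1 hv).1) hne (hclique l) hE
    rwa [hN, cardS] at this
  have le3 : ∀ l, #(layerColumns c i l) ≤ 3 := by
    intro l
    by_contra! hcon
    have h1 := bound l (card_pos.1 (by rw [cardS]; omega)) ∅ (by simp)
    have h2 := Nat.mul_le_mul_right #(layerColumns c i l) hcon
    omega
  have ne3 : ∀ l, #(layerColumns c i l) ≠ 3 := by
    intro l h3
    -- two vertices of a common foreign colour span a `K_{3,2}` with the three vertices of the layer
    obtain ⟨a, ha, b, hb, hab, hcab⟩ := exists_ne_map_eq_of_card_lt_of_maps_to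
      (s := (layerColumns c i l)ᶜ) (t := univ.erase i) (f := fun a => c (a, l))
      (by rw [card_compl, h3, card_erase_of_mem (mem_univ _), card_univ, Fintype.card_fin,
            Fintype.card_fin]; omega)
      (by intro a ha; simpa using ha)
    have hai : c (a, l) ≠ i := by simpa using ha
    have hbi : c (b, l) ≠ i := by simpa using hb
    have hsub : layerColumns c i l ⊆ {(p (a, l) i).1, (p (b, l) i).1} := by
      intro x hx
      have hx := mem_layerColumns.1 hx
      -- an edge of the `K_{3,2}` that is not a pointer would exceed the edge count
      have all : ∀ y, c (y, l) ≠ i → p (x, l) (c (y, l)) = (y, l) ∨ p (y, l) i = (x, l) := by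
        intro y hy
        by_contra! hcon
        have hxy : (completeBoxCycle m (n + 3)).Adj (x, l) (y, l) :=
          completeBoxCycle_adj.2 (Or.inl ⟨rfl, fun e => hy (by
            have e : x = y := e
            rw [← e]; exact hx)⟩)
        have := bound l (card_pos.1 (by rw [cardS]; omega)) {((x, l), (y, l))} (by
          intro d hd
          rw [mem_singleton] at hd
          subst hd
          exact ⟨hxy, hx, hy, hcon.1, hcon.2⟩)
        rw [h3, card_singleton] at this
        omega
      simp only [mem_insert, mem_singleton]
      rcases all a hai with e | e
      · rcases all b hbi with e' | e'
        · have hcab : c (a, l) = c (b, l) := hcab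
          rw [← hcab, e] at e'
          exact absurd (Prod.ext_iff.1 e').1 hab
        · exact Or.inr (by rw [e'])
      · exact Or.inl (by rw [e])
    have := (card_le_card hsub).trans card_le_two
    omega
  have ne0 : ∀ l, #(layerColumns c i l) ≠ 0 := by
    intro l h0
    have hempty : ∀ a, c (a, l) ≠ i := by
      intro a ha
      rw [card_eq_zero] at h0
      have := mem_layerColumns.2 ha
      simp [h0] at this
    have hsub : univ ⊆ layerColumns c i (l + 1) ∪ layerColumns c i (l - 1) := by
      intro a _
      rw [mem_union, mem_layerColumns, mem_layerColumns]
      rcases h.pointer_cases (hempty a).symm with ⟨b, -, e⟩ | ⟨-, e⟩ | ⟨-, e⟩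
      · exact absurd e (hempty b)
      · exact Or.inl e
      · exact Or.inr e
    have h1 := (card_le_card hsub).trans (card_union_le _ _)
    rw [card_univ, Fintype.card_fin] at h1
    have h2 := le3 (l + 1)
    have h3 := le3 (l - 1)
    omega
  refine ⟨fun l => ⟨?_, ?_⟩, ?_⟩
  · have := ne0 l; omega
  · have := le3 l
    have := ne3 l
    omega
  · have h0 := ne0 0
    have h1 := bound 0 (card_pos.1 (by rw [cardS]; omega)) ∅ (by simp)
    have h2 := le3 0
    have h3 := ne3 0
    have h4 : #(layerColumns c i 0) = 1 ∨ #(layerColumns c i 0) = 2 := by omega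
    rcases h4 with e | e <;> simp only [e, card_empty] at h1 <;> omega

/-- The class considered is one of at most average size; the exceptions are exactly the cases with
one single layer that the local analysis leaves open. -/
lemma not_hasCIST_completeBoxCycle (hk : 4 ≤ k) (hm : m + 1 = 2 * k)
    (hex : ¬ ((k = 4 ∧ (n = 0 ∨ n = 1)) ∨ (k = 5 ∧ (n = 1 ∨ n = 2)))) :
    ¬ HasCIST (completeBoxCycle m (n + 3)) k := by
  classical
  rintro ⟨T, hT⟩
  have : NeZero k := ⟨by omega⟩
  have : NeZero m := ⟨by omega⟩
  obtain ⟨c, p, h⟩ := hT.exists_partition (by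
    rw [Fintype.card_prod, Fintype.card_fin, Fintype.card_fin]
    nlinarith)
  obtain ⟨i, hi⟩ : ∃ i, k * #{v | c v = i} ≤ m * (n + 3) := by
    by_contra! hcon
    have h1 : ∑ i : Fin k, m * (n + 3) < ∑ i : Fin k, k * #{v | c v = i} :=
      sum_lt_sum_of_nonempty ⟨0, mem_univ _⟩ fun i _ => hcon i
    rw [sum_const, ← mul_sum, sum_card_class, card_univ] at h1
    simp at h1
  obtain ⟨hl, hD⟩ := h.card_layerColumns_of_small hk hm hi
  have h1 := fun l => (hl l).1
  have h2 := fun l => (hl l).2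
  -- the number `s` of layers with a single vertex satisfies `n + 3 ≤ k s ≤ n + 5`
  set Z : Finset (Fin (n + 3)) := {l | #(layerColumns c i l) = 1} with hZ
  have hsum : #{v | c v = i} + #Z = 2 * (n + 3) := by
    rw [← sum_card_layerColumns, hZ, card_filter, ← sum_add_distrib]
    have : ∀ l, #(layerColumns c i l) + (if #(layerColumns c i l) = 1 then 1 else 0) = 2 := by
      intro l
      have := h1 l
      have := h2 l
      split_ifs <;> omega
    simp [this, mul_comm]
  have hks : k * #{v | c v = i} + k * #Z = (m + 1) * (n + 3) := by
    rw [← mul_add, hsum, hm]; ring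
  have hks' : (m + 1) * (n + 3) = m * (n + 3) + (n + 3) := by ring
  have hlow : n + 3 ≤ k * #Z := by omega
  have hupp : k * #Z ≤ n + 5 := by omega
  have hlayer : ∀ l, ∃ a, (a, l) ∈ {v | c v = i} := fun l => by
    obtain ⟨a, ha⟩ := card_pos.1 (h1 l)
    exact ⟨a, mem_layerColumns.1 ha⟩
  -- the single layers are the two layers of the unique unlinked pair
  have hgap : ∀ l ∈ Z, ¬ Linked {v | c v = i} l ∨ ¬ Linked {v | c v = i} (l - 1) := by
    intro l hlZ
    obtain ⟨α, hα⟩ := card_eq_one.1 (mem_filter.1 hlZ).2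
    rw [linked_class_iff_of_singleton hα, linked_class_sub_one_iff_of_singleton hα]
    rcases (h.singleton_layer hk h1 h2 hα).1 with e | e
    · exact Or.inl e.1
    · exact Or.inr e.2
  obtain ⟨l, hlZ⟩ : Z.Nonempty := by
    rw [nonempty_iff_ne_empty]
    intro e
    rw [e] at hlow
    simp at hlow
  obtain ⟨g, hg⟩ : ∃ g, ¬ Linked {v | c v = i} g := by
    rcases hgap l hlZ with e | e
    · exact ⟨_, e⟩
    · exact ⟨_, e⟩
  have hZg : Z ⊆ {g, g + 1} := by
    intro l' hl'
    rw [mem_insert, mem_singleton]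
    rcases hgap l' hl' with e | e
    · exact Or.inl (eq_of_not_linked (h.connected i) hlayer e hg)
    · exact Or.inr (by rw [← eq_of_not_linked (h.connected i) hlayer e hg, sub_add_cancel])
  by_cases hboth : g ∈ Z ∧ g + 1 ∈ Z
  · obtain ⟨α, hα⟩ := card_eq_one.1 (mem_filter.1 hboth.1).2
    obtain ⟨β, hβ⟩ := card_eq_one.1 (mem_filter.1 hboth.2).2
    exact h.no_unlinked_singletons hk h1 h2 hα hβ
      (mt (linked_class_iff_of_singleton hα).2 hg)
  · have hZ1 : #Z ≤ 1 := by
      rw [card_le_one]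
      intro x hx y hy
      have hx' := hZg hx
      have hy' := hZg hy
      rw [mem_insert, mem_singleton] at hx' hy'
      rcases hx' with rfl | rfl <;> rcases hy' with rfl | rfl
      · rfl
      · exact absurd ⟨hx, hy⟩ hboth
      · exact absurd ⟨hy, hx⟩ hboth
      · rfl
    have hZ2 : #Z = 1 := by
      have := card_pos.2 ⟨l, hlZ⟩
      omega
    rw [hZ2, mul_one] at hlow hupp
    obtain ⟨α, hα⟩ := card_eq_one.1 (mem_filter.1 hlZ).2
    have h5 := (h.singleton_layer hk h1 h2 hα).2
    have h6 := h2 (l + 1)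
    have h7 := h2 (l - 1)
    by_cases hn : n = 0
    · subst hn
      have := h.le_four_of_three_layers hk h1 h2 hα
      omega
    · omega

end Nonexistence

end CIST

/-! ### The maximum number of trees -/

namespace CIST

section Maximum

variable {m n : ℕ}

lemma hasCIST_three : HasCIST (completeBoxCycle 3 (n + 3)) 2 := by
  rcases Nat.even_or_odd' n with ⟨q, h | h⟩
  · exact hasCIST_three_of_eq_three_add q (by omega)
  · exact hasCIST_three_of_eq_two_add (q + 1) (by omega)

lemma hasCIST_five : HasCIST (completeBoxCycle 5 (n + 3)) 3 := by
  have h : n % 3 = 0 ∨ n % 3 = 1 ∨ n % 3 = 2 := by omega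
  rcases h with h | h | h
  · exact hasCIST_five_of_eq_three_add (n / 3) (by omega)
  · exact hasCIST_five_of_eq_four_add (n / 3) (by omega)
  · exact hasCIST_five_of_eq_five_add (n / 3) (by omega)

lemma isGreatest_hasCIST_of_exceptional (h : m = 3 ∨ m = 5 ∨ (m = 7 ∧ (n = 0 ∨ n = 1)) ∨
    (m = 9 ∧ (n = 1 ∨ n = 2))) :
    IsGreatest {k | HasCIST (completeBoxCycle m (n + 3)) k} ((m + 1) / 2) := by
  refine ⟨?_, fun k hk => ?_⟩
  · rcases h with rfl | rfl | ⟨rfl, rfl | rfl⟩ | ⟨rfl, rfl | rfl⟩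
    · exact hasCIST_three
    · exact hasCIST_five
    · exact hasCIST_seven_three
    · exact hasCIST_seven_four
    · exact hasCIST_nine_four
    · exact hasCIST_nine_five
  · have := HasCIST.le_of_completeBoxCycle (by omega) hk
    omega

lemma isGreatest_hasCIST_of_not_exceptional (hm : 3 ≤ m) (h : ¬ (m = 3 ∨ m = 5 ∨
    (m = 7 ∧ (n = 0 ∨ n = 1)) ∨ (m = 9 ∧ (n = 1 ∨ n = 2)))) :
    IsGreatest {k | HasCIST (completeBoxCycle m (n + 3)) k} (m / 2) := by
  refine ⟨hasCIST_half (by omega), fun k hk => ?_⟩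
  have h1 := HasCIST.le_of_completeBoxCycle hm hk
  by_contra! hlt
  have h2 : m + 1 = 2 * k := by omega
  exact not_hasCIST_completeBoxCycle (by omega) h2 (by omega) hk

end Maximum

end CIST

theorem mainTheorem1 :
    (∀ m n : ℕ, 3 ≤ m → 3 ≤ n →
      IsGreatest {k : ℕ | CIST.HasCIST (CIST.completeBoxCycle m n) k}
          (CIST.mcist (CIST.completeBoxCycle m n)) ∧
        (m = 3 ∨ m = 5 ∨ (m = 7 ∧ (n = 3 ∨ n = 4)) ∨ (m = 9 ∧ (n = 4 ∨ n = 5)) →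
          CIST.mcist (CIST.completeBoxCycle m n) = ⌈(m : ℚ) / 2⌉₊) ∧
        (¬ (m = 3 ∨ m = 5 ∨ (m = 7 ∧ (n = 3 ∨ n = 4)) ∨ (m = 9 ∧ (n = 4 ∨ n = 5))) →
          CIST.mcist (CIST.completeBoxCycle m n) = ⌊(m : ℚ) / 2⌋₊)) ∧
    (∀ r n : ℕ, 4 ≤ r → 3 ≤ n →
      ¬ ((r = 4 ∧ (n = 3 ∨ n = 4)) ∨ (r = 5 ∧ (n = 4 ∨ n = 5))) →
        (CIST.completeBoxCycle (2 * r - 1) n).IsRegularOfDegree (2 * r) ∧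
          CIST.IsVertexConnected (CIST.completeBoxCycle (2 * r - 1) n) (2 * r) ∧
          ¬ CIST.HasCIST (CIST.completeBoxCycle (2 * r - 1) n) r) := by
  constructor
  · intro m n hm hn
    obtain ⟨n, rfl⟩ : ∃ n', n = n' + 3 := ⟨n - 3, by omega⟩
    by_cases h : m = 3 ∨ m = 5 ∨ (m = 7 ∧ (n = 0 ∨ n = 1)) ∨ (m = 9 ∧ (n = 1 ∨ n = 2))
    · have hg := CIST.isGreatest_hasCIST_of_exceptional h
      have he : CIST.mcist (CIST.completeBoxCycle m (n + 3)) = (m + 1) / 2 := hg.csSup_eq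
      rw [he]
      refine ⟨hg, fun _ => ?_, fun h' => absurd h (by omega)⟩
      have hodd : m = 3 ∨ m = 5 ∨ m = 7 ∨ m = 9 := by omega
      rcases hodd with rfl | rfl | rfl | rfl <;>
      · symm
        rw [Nat.ceil_eq_iff (by norm_num)]
        norm_num
    · have hg := CIST.isGreatest_hasCIST_of_not_exceptional hm h
      have he : CIST.mcist (CIST.completeBoxCycle m (n + 3)) = m / 2 := hg.csSup_eq
      rw [he]
      refine ⟨hg, fun h' => absurd h' (by omega), fun _ => ?_⟩
      exact (Nat.floor_div_eq_div (K := ℚ) m 2).symm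
  · intro r n hr hn hex
    obtain ⟨n, rfl⟩ : ∃ n', n = n' + 3 := ⟨n - 3, by omega⟩
    refine ⟨fun v => ?_, ?_, CIST.not_hasCIST_completeBoxCycle hr (by omega) (by omega)⟩
    · rw [CIST.completeBoxCycle_degree]
      omega
    · have := CIST.completeBoxCycle_isVertexConnected (m := 2 * r - 1) (n := n) (by omega)
      rwa [show 2 * r - 1 + 1 = 2 * r by omega] at this
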